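/- Let $H$ be a real Hilbert space and $A$ a positive self-adjoint operator in $H$ with an orthonormal eigenbasis $(e_k)_{k\ge1}$, $Ae_k=\lambda_ke_k$, $0<\lambda_1\le\lambda_2\le\dots$, $\lambda_k\to\infty$. For $r\in\mathbb R$ let $F_r=D(A^r)$ with $(v,w)_r=(A^rv,A^rw)$, so that $F_0=H$; for $r<0$ these are the spaces of formal series $\sum_k c_ke_k$ with $\sum_k\lambda_k^{2r}c_k^2<\infty$. Let $\beta,\nu>0$, $\omega\ge0$, $p\in H$. For $i=1,2$ let $\mu_i\in C^1(0,\infty)\cap C[0,\infty)\cap L^1(0,\infty)$ satisfy $\mu_i\ge0$ and $\mu_i'+\delta_i\mu_i\le0$ on $(0,\infty)$ for some $\delta_i>0$. Let $M\in C^2(0,\infty)$ be integrable near $0$ with $\int_0^zM(\xi)\,d\xi\ge-az-b$ for all $z\ge0$, where $a\in(0,\lambda_1)$ and $b\in\mathbb R$. For a Hilbert space $E$ let $L^2_{\mu_i}(\mathbb R_+;E)$ be the space of (classes of) measurable $\xi:(0,\infty)\to E$ with $\int_0^\infty\mu_i(s)\|\xi(s)\|_E^2\,ds<\infty$. Put $$\mathcal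 H=F_1\times F_0\times F_0\times L^2_{\mu_1}(\mathbb R_+;F_1)\times L^2_{\mu_2}(\mathbb R_+;F_{1/2}),$$ and for $U=(u,w,v,\overline\eta,\eta)\in\mathcal H$ $$\mathcal LU=\begin{pmatrix}w\\-\beta A^2u-\int_0^\infty\mu_1(s)A^2\overline\eta(s)\,ds+\nu Av\\-\omega Av-\int_0^\infty\mu_2(s)A\eta(s)\,ds-\nu Aw\\-\overline\eta_s+w\\-\eta_s+v\end{pmatrix},\qquad f(U)=\begin{pmatrix}0\\-M(\|A^{1/2}u\|^2)Au+p\\0\\0\\0\end{pmatrix},$$ where $D(\mathcal L)$ consists of the $U\in\mathcal H$ such that $w\in F_1$, $v\in F_{1/2}$, the distributional derivatives satisfy $\overline\eta_s\in L^2_{\mu_1}(\mathbb R_+;F_1)$, $\eta_s\in L^2_{\mu_2}(\mathbb R_+;F_{1/2})$, $\overline\eta(0)=0$, $\eta(0)=0$, and $\beta A^2u+\int_0^\infty\mu_1A^2\overline\eta\,ds-\nu Av\in F_0$, $\omega Av+\int_0^\infty\mu_2A\eta\,ds\in F_0$. Let $T>0$ and let $U(t)=(u(t),w(t),v(t),\overline\eta^t,\eta^t)$,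 $t\in[0,T]$, be a mild solution of $\dot U=\mathcal LU+f(U)$ with initial data $U_0=(u_0,w_0,v_0,\overline\eta_0,\eta_0)\in\mathcal H$; that is, $U\in C([0,T];\mathcal H)$, $f(U)\in L^1(0,T;\mathcal H)$ and $$U(t)=e^{t\mathcal L}U_0+\int_0^te^{(t-\tau)\mathcal L}f(U(\tau))\,d\tau,\qquad t\in[0,T],$$ where $e^{t\mathcal L}$ is the strongly continuous semigroup on $\mathcal H$ with infinitesimal generator $\mathcal L$. Then for every $t\in[0,T]$, as elements of $L^2_{\mu_1}(\mathbb R_+;F_1)$ and $L^2_{\mu_2}(\mathbb R_+;F_{1/2})$ respectively (that is, for almost every $s>0$ with respect to $\mu_1(s)\,ds$, respectively $\mu_2(s)\,ds$), $$\overline\eta^t(s)=\begin{cases}u(t)-u(t-s),&0<s<t,\\ \overline\eta_0(s-t)+u(t)-u(0),&s\ge t,\end{cases}\qquad \eta^t(s)=\begin{cases}\int_0^sv(t-y)\,dy,&0<s<t,\\ \eta_0(s-t)+\int_0^tv(t-y)\,dy,&s\ge t,\end{cases}$$ where the integrals of $v$ are taken in $H$. -/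

import Mathlib

open MeasureTheory Set Filter Topology
open scoped ENNReal

noncomputable section

namespace PlateMemory

/-- The spectral data of a positive self-adjoint operator `A` on a real Hilbert space `H`: an
orthonormal eigenbasis `e k` with eigenvalues `0 < lam 0 ≤ lam 1 ≤ ...` tending to infinity.
The operator is `A v = ∑ lam k (v, e k) e k`, on the domain where this series converges
(a self-adjoint operator is determined by such an eigenbasis). -/
structure EigenSystem (H : Type*) [NormedAddCommGroup H] [InnerProductSpace ℝ H] where
  e : HilbertBasis ℕ ℝ H
  lam : ℕ → ℝ
  lam_zero_pos : 0 < lam 0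
  lam_mono : Monotone lam
  lam_tendsto : Tendsto lam atTop atTop

section Scale

variable {H : Type*} [NormedAddCommGroup H] [InnerProductSpace ℝ H] (D : EigenSystem H)

theorem EigenSystem.lam_pos (k : ℕ) : 0 < D.lam k :=
  D.lam_zero_pos.trans_le (D.lam_mono (Nat.zero_le k))

theorem memlp_iff_coeff (r : ℝ) (v : H) :
    Memℓp (fun k => D.lam k ^ r * inner ℝ (D.e k) v) 2 ↔
      Summable (fun k => D.lam k ^ (2 * r) * (inner ℝ (D.e k) v) ^ 2) := by
  rw [memℓp_gen_iff (by norm_num)]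
  refine summable_congr fun k => ?_
  have h := D.lam_pos k
  have h2 : D.lam k ^ (2 * r) = (D.lam k ^ r) ^ 2 := by
    rw [mul_comm, Real.rpow_mul h.le]; norm_cast
  rw [h2]
  simp [mul_pow]

/-- The domain `D(A^r) = {v : ∑ lam k ^ (2 r) (v, e k)² < ∞}`, as a subspace of `H` (`r ≥ 0`). -/
def powDomain (r : ℝ) : Submodule ℝ H where
  carrier := {v | Summable (fun k => D.lam k ^ (2 * r) * (inner ℝ (D.e k) v) ^ 2)}
  zero_mem' := by simp [summable_zero]
  add_mem' := by
    intro a b ha hb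
    simp only [mem_ofPred_eq, ← memlp_iff_coeff] at *
    convert ha.add hb using 1
    funext k
    simp [inner_add_right, mul_add]
  smul_mem' := by
    intro c a ha
    simp only [mem_ofPred_eq, ← memlp_iff_coeff] at *
    convert ha.const_smul c using 1
    funext k
    simp [inner_smul_right]
    ring

/-- The power `A^r : D(A^r) → H`, `A^r v = ∑ lam k ^ r (v, e k) e k`. -/
def powA (r : ℝ) : powDomain D r →ₗ[ℝ] H where
  toFun v := D.e.repr.symm ⟨fun k => D.lam k ^ r * inner ℝ (D.e k) (v : H),
    (memlp_iff_coeff D r v).2 v.2⟩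
  map_add' v w := by
    rw [← map_add]
    congr 1
    ext k
    change D.lam k ^ r * inner ℝ (D.e k) ((v : H) + w) = D.lam k ^ r * inner ℝ (D.e k) (v : H) +
      D.lam k ^ r * inner ℝ (D.e k) (w : H)
    rw [inner_add_right, mul_add]
  map_smul' c v := by
    rw [RingHom.id_apply, ← map_smul]
    congr 1
    ext k
    simp [inner_smul_right]
    ring

theorem inner_powA (r : ℝ) (v : powDomain D r) (k : ℕ) :
    inner ℝ (D.e k) (powA D r v) = D.lam k ^ r * inner ℝ (D.e k) (v : H) := by
  rw [← D.e.repr_apply_apply]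
  simp [powA]

theorem powA_injective (r : ℝ) : Function.Injective (powA D r) := by
  intro v w h
  apply Subtype.ext
  apply D.e.repr.injective
  ext k
  rw [D.e.repr_apply_apply, D.e.repr_apply_apply]
  have h1 := inner_powA D r v k
  rw [h, inner_powA] at h1
  exact (mul_left_cancel₀ (Real.rpow_pos_of_pos (D.lam_pos k) r).ne' h1).symm

/-- The space `F_r = D(A^r)`, a copy of `powDomain D r` that carries the inner product
`(v, w)_r = (A^r v, A^r w)` and not the one of `H`. -/
def F (r : ℝ) : Type _ := powDomain D r

instance (r : ℝ) : AddCommGroup (F D r) := inferInstanceAs (AddCommGroup (powDomain D r))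
instance (r : ℝ) : Module ℝ (F D r) := inferInstanceAs (Module ℝ (powDomain D r))

/-- The inclusion `F_r ⊆ H`. -/
def incl (r : ℝ) : F D r →ₗ[ℝ] H := (powDomain D r).subtype

/-- The power `A^r : F_r → H`. -/
def pow (r : ℝ) : F D r →ₗ[ℝ] H := powA D r

instance (r : ℝ) : NormedAddCommGroup (F D r) :=
  NormedAddCommGroup.induced (F D r) H (pow D r) (powA_injective D r)

instance (r : ℝ) : InnerProductSpace ℝ (F D r) where
  inner v w := inner ℝ (pow D r v) (pow D r w)
  norm_smul_le c v := by
    change ‖pow D r (c • v)‖ ≤ ‖c‖ * ‖pow D r v‖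
    rw [map_smul, norm_smul]
  norm_sq_eq_re_inner v := by
    change ‖pow D r v‖ ^ 2 = _
    simp
  conj_inner_symm v w := by simp [real_inner_comm]
  add_left u v w := by simp [inner_add_left]
  smul_left c v w := by simp [inner_smul_left]

theorem pow_surjective {r : ℝ} (hr : 0 ≤ r) : Function.Surjective (pow D r) := by
  intro h
  have hle : ∀ k, D.lam k ^ (-r) ≤ D.lam 0 ^ (-r) := fun k =>
    Real.rpow_le_rpow_of_nonpos D.lam_zero_pos (D.lam_mono (Nat.zero_le k)) (by linarith)
  have hm : Memℓp (fun k => D.lam k ^ (-r) * inner ℝ (D.e k) h) 2 := by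
    have h0 : Memℓp (fun k => D.lam 0 ^ (-r) * inner ℝ (D.e k) h) 2 := by
      have h1 : Memℓp (fun k => D.e.repr h k) 2 := (D.e.repr h).2
      convert h1.const_smul (D.lam 0 ^ (-r)) using 1
      funext k
      simp [D.e.repr_apply_apply]
    rw [memℓp_gen_iff (by norm_num)] at h0 ⊢
    refine h0.of_nonneg_of_le (fun k => by positivity) fun k => ?_
    refine Real.rpow_le_rpow (norm_nonneg _) ?_ (by norm_num)
    rw [norm_mul, norm_mul, Real.norm_of_nonneg (Real.rpow_nonneg (D.lam_pos k).le (-r)),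
      Real.norm_of_nonneg (Real.rpow_nonneg D.lam_zero_pos.le (-r))]
    exact mul_le_mul_of_nonneg_right (hle k) (norm_nonneg _)
  set x : H := D.e.repr.symm ⟨_, hm⟩ with hx
  have hxk : ∀ k, inner ℝ (D.e k) x = D.lam k ^ (-r) * inner ℝ (D.e k) h := fun k => by
    rw [← D.e.repr_apply_apply, hx]; simp
  have hk : ∀ k, D.lam k ^ r * inner ℝ (D.e k) x = D.e.repr h k := fun k => by
    rw [hxk, ← mul_assoc, ← Real.rpow_add (D.lam_pos k), D.e.repr_apply_apply]; simp
  have hxm : x ∈ powDomain D r := by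
    change Summable _
    rw [← memlp_iff_coeff]
    simp only [hk]
    exact (D.e.repr h).2
  refine ⟨⟨x, hxm⟩, ?_⟩
  apply D.e.repr.injective
  ext k
  rw [← hk, D.e.repr_apply_apply]
  exact inner_powA D r ⟨x, hxm⟩ k

/-- For `r ≥ 0` the space `F_r` is a Hilbert space. -/
theorem completeSpace_F [CompleteSpace H] {r : ℝ} (hr : 0 ≤ r) : CompleteSpace (F D r) := by
  have hi : Isometry (pow D r) := AddMonoidHomClass.isometry_of_norm _ fun _ => rfl
  rw [completeSpace_iff_isComplete_univ, ← isComplete_image_iff hi.isUniformInducing,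
    image_univ, (pow_surjective D hr).range_eq]
  exact completeSpace_iff_isComplete_univ.1 inferInstance

end Scale

/-- The assumptions on a memory kernel `μ` with decay rate `δ`. -/
structure IsMemoryKernel (μ : ℝ → ℝ) (δ : ℝ) : Prop where
  contDiffOn : ContDiffOn ℝ 1 μ (Ioi 0)
  continuousOn : ContinuousOn μ (Ici 0)
  integrableOn : IntegrableOn μ (Ioi 0)
  nonneg : ∀ s, 0 < s → 0 ≤ μ s
  decay : ∀ s, 0 < s → deriv μ s + δ * μ s ≤ 0

/-- The measure `μ(s) ds` on `(0, ∞)`. -/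
def weight (μ : ℝ → ℝ) : Measure ℝ :=
  (volume.restrict (Ioi 0)).withDensity fun s => ENNReal.ofReal (μ s)

/-- The weighted space `L²_μ((0, ∞); E)`. -/
abbrev MemorySpace (μ : ℝ → ℝ) (E : Type*) [NormedAddCommGroup E] : Type _ :=
  Lp E 2 (weight μ)

/-- `η ∈ L²_μ((0, ∞); E)` has the distributional derivative `ξ ∈ L²_μ((0, ∞); E)` and `η(0) = 0`.
An element of `L²_μ` is a function up to equality almost everywhere on the open set
`{s > 0 : μ s > 0}`, so the test functions are those supported there; `η(0) = 0` means
that `η` has a representative with limit `0` at `0+`. -/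
def HasMemoryDeriv (μ : ℝ → ℝ) {E : Type*} [NormedAddCommGroup E] [NormedSpace ℝ E]
    (η ξ : MemorySpace μ E) : Prop :=
  (∀ φ : ℝ → ℝ, ContDiff ℝ (⊤ : ℕ∞) φ → HasCompactSupport φ → tsupport φ ⊆ {s | 0 < s ∧ 0 < μ s} →
      ∫ s, deriv φ s • η s = - ∫ s, φ s • ξ s) ∧
    ∃ g : ℝ → E, (∀ᵐ s ∂weight μ, η s = g s) ∧ Tendsto g (𝓝[>] 0) (𝓝 0)

section Semigroups

variable {X : Type*} [NormedAddCommGroup X] [NormedSpace ℝ X]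

/-- `S t`, `t ≥ 0`, is a strongly continuous semigroup of bounded linear operators
(values at `t < 0` are irrelevant). -/
structure IsC0Semigroup (S : ℝ → X →L[ℝ] X) : Prop where
  zero : S 0 = ContinuousLinearMap.id ℝ X
  add : ∀ s t, 0 ≤ s → 0 ≤ t → S (s + t) = (S s).comp (S t)
  tendsto : ∀ x, Tendsto (fun t => S t x) (𝓝[>] 0) (𝓝 x)

/-- The (possibly unbounded) operator whose graph is `L` (`L x y` says that `x` is in the domain
and is mapped to `y`) is the infinitesimal generator of `S`. -/
def IsGenerator (S : ℝ → X →L[ℝ] X) (L : X → X → Prop) : Prop :=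
  ∀ x y, L x y ↔ Tendsto (fun h : ℝ => h⁻¹ • (S h x - x)) (𝓝[>] 0) (𝓝 y)

/-- `U` is a mild solution on `[0, T]` of `U' = L U + f(U)`, `U(0) = U₀`, where `L` is given by its
graph: `U` is continuous, `f(U)` is integrable and
`U(t) = e^{tL} U₀ + ∫_0^t e^{(t-τ)L} f(U(τ)) dτ`, where `e^{tL}` is the strongly continuous
semigroup generated by `L`. -/
def IsMildSolution (L : X → X → Prop) (f : X → X) (T : ℝ) (U₀ : X) (U : ℝ → X) : Prop :=
  ∃ S : ℝ → X →L[ℝ] X, IsC0Semigroup S ∧ IsGenerator S L ∧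
    ContinuousOn U (Icc 0 T) ∧ IntegrableOn (fun τ => f (U τ)) (Icc 0 T) ∧
    ∀ t ∈ Icc 0 T, U t = S t U₀ + ∫ τ in (0 : ℝ)..t, S (t - τ) (f (U τ))

end Semigroups

section Phase

variable {H : Type*} [NormedAddCommGroup H] [InnerProductSpace ℝ H]

/-- The phase space `F_1 × F_0 × F_0 × L²_{μ₁}(F_1) × L²_{μ₂}(F_{1/2})`, with `F_0 = H`. Only its
linear structure and its topology are used; the maximum norm of the product is equivalent to the
Hilbert norm. -/
abbrev Phase (D : EigenSystem H) (μ₁ μ₂ : ℝ → ℝ) : Type _ :=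
  F D 1 × H × H × MemorySpace μ₁ (F D 1) × MemorySpace μ₂ (F D (1 / 2))

variable {D : EigenSystem H} {μ₁ μ₂ : ℝ → ℝ}

/-- The component `u`. -/
abbrev uPart (U : Phase D μ₁ μ₂) : F D 1 := U.1

/-- The component `w`. -/
abbrev wPart (U : Phase D μ₁ μ₂) : H := U.2.1

/-- The component `v`. -/
abbrev vPart (U : Phase D μ₁ μ₂) : H := U.2.2.1

/-- The memory component `η̄`. -/
abbrev etaBar (U : Phase D μ₁ μ₂) : MemorySpace μ₁ (F D 1) := U.2.2.2.1

/-- The memory component `η`. -/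
abbrev eta (U : Phase D μ₁ μ₂) : MemorySpace μ₂ (F D (1 / 2)) := U.2.2.2.2

/-- The graph of the linear operator `𝓛`: `U ∈ D(𝓛)` and `𝓛 U = V`. The identities for the
second and the third component hold in `F_{-1}` and `F_{-1/2}`, that is, coefficient by
coefficient with respect to the eigenbasis; as `V` has its components in `H`, they contain the
requirement that the right-hand sides be in `H`. -/
structure LinGraph (D : EigenSystem H) (β ω ν : ℝ) (μ₁ μ₂ : ℝ → ℝ)
    (U V : Phase D μ₁ μ₂) : Prop where
  /-- `w ∈ F_1`, and the first component of `𝓛 U` is `w`. -/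
  comp_u : incl D 1 (uPart V) = wPart U
  /-- The second component is `-β A² u - ∫ μ₁(s) A² η̄(s) ds + ν A v`. -/
  comp_w : ∀ k, inner ℝ (D.e k) (wPart V) =
    - β * D.lam k ^ 2 * inner ℝ (D.e k) (incl D 1 (uPart U))
    - (∫ s in Ioi (0 : ℝ), μ₁ s * (D.lam k ^ 2 * inner ℝ (D.e k) (incl D 1 (etaBar U s))))
    + ν * D.lam k * inner ℝ (D.e k) (vPart U)
  /-- The third component is `-ω A v - ∫ μ₂(s) A η(s) ds - ν A w`. -/
  comp_v : ∀ k, inner ℝ (D.e k) (vPart V) =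
    - ω * D.lam k * inner ℝ (D.e k) (vPart U)
    - (∫ s in Ioi (0 : ℝ), μ₂ s * (D.lam k * inner ℝ (D.e k) (incl D (1 / 2) (eta U s))))
    - ν * D.lam k * inner ℝ (D.e k) (wPart U)
  /-- `η̄ ∈ D(T̄)`, and the fourth component is `-η̄_s + w`. -/
  comp_etaBar : ∃ w : F D 1, incl D 1 w = wPart U ∧
    ∃ ξ : MemorySpace μ₁ (F D 1), HasMemoryDeriv μ₁ (etaBar U) ξ ∧
      ∀ᵐ s ∂weight μ₁, etaBar V s = - ξ s + w
  /-- `η ∈ D(T)`, `v ∈ F_{1/2}`, and the fifth component is `-η_s + v`. -/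
  comp_eta : ∃ v : F D (1 / 2), incl D (1 / 2) v = vPart U ∧
    ∃ ξ : MemorySpace μ₂ (F D (1 / 2)), HasMemoryDeriv μ₂ (eta U) ξ ∧
      ∀ᵐ s ∂weight μ₂, eta V s = - ξ s + v

theorem powDomain_one_le_half (D : EigenSystem H) : powDomain D 1 ≤ powDomain D (1 / 2) := by
  intro v hv
  have hv' : Summable (fun k => D.lam k ^ ((2 : ℝ) * 1) * (inner ℝ (D.e k) v) ^ 2) := hv
  change Summable _
  refine (hv'.mul_left (D.lam 0)⁻¹).of_nonneg_of_le
    (fun k => mul_nonneg (Real.rpow_nonneg (D.lam_pos k).le _) (sq_nonneg _)) fun k => ?_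
  have h0 := D.lam_zero_pos
  have hk := D.lam_mono (Nat.zero_le k)
  have hle : D.lam k ≤ (D.lam 0)⁻¹ * D.lam k ^ 2 := by
    rw [le_inv_mul_iff₀ h0]
    nlinarith
  have e1 : D.lam k ^ ((2 : ℝ) * (1 / 2)) = D.lam k := by norm_num
  have e2 : D.lam k ^ ((2 : ℝ) * 1) = D.lam k ^ 2 := by norm_num
  rw [e1, e2, ← mul_assoc]
  exact mul_le_mul_of_nonneg_right hle (sq_nonneg _)

/-- The inclusion `F_1 ⊆ F_{1/2}`. -/
def oneToHalf (D : EigenSystem H) : F D 1 →ₗ[ℝ] F D (1 / 2) :=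
  Submodule.inclusion (powDomain_one_le_half D)

/-- The nonlinear term `f(U) = (0, -M(‖A^{1/2} u‖²) A u + p, 0, 0, 0)`. -/
def nonlin (D : EigenSystem H) (μ₁ μ₂ : ℝ → ℝ) (M : ℝ → ℝ) (p : H) (U : Phase D μ₁ μ₂) :
    Phase D μ₁ μ₂ :=
  (0, - M (‖pow D (1 / 2) (oneToHalf D (uPart U))‖ ^ 2) • pow D 1 (uPart U) + p, 0, 0, 0)

end Phase

end PlateMemory

end

/-! The memory equations are transport equations `η̄_s + η̄_t = w`, `η_s + η_t = v` with zero inflow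
at `s = 0`, and the claimed formulas are integration along characteristics. A mild solution need not
be differentiable or lie in the domain of the generator, so the characteristics are followed on the
dual side.

Fix an eigenvector index `k` and a smooth `φ` with compact support in `{s > 0 : μ s > 0}`, and let
`b` be the largest point of its support. The functionals `ℓ σ U = ∫_0^b φ(s + t - σ) (η(s), e_k) ds`
carry the test function back along characteristics. On the domain, integration by parts cancels the
transport term against the `σ`-derivative and leaves only the source, `c σ * (v, e_k)` with `c σ =
∫_0^b φ(s + t - σ) ds` (`IsTransported.exists_adjointFamily`). The shifted test function need not
vanish near `0`; this is where the boundary condition enters, through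
`integral_deriv_mul_of_vanishing`.

Such an identity passes from the domain to semigroup orbits by density and to mild solutions by
Duhamel's formula and Fubini (`IsMildSolution.pairing`). The nonlinearity acts only on the `w`
component, so it is annihilated. Since `φ` is arbitrary, each coefficient of the memory variable is
identified almost everywhere (`IsMildSolution.transported_coeff`), and countably many coefficients
determine it. For `η̄`, pairing with the coefficients of `u` turns the integral of `w` into a
difference of values of `u`. -/

namespace PlateMemory

/-! ### Strongly continuous semigroups and their generators -/

section Semigroups

variable {X : Type*} [NormedAddCommGroup X] [NormedSpace ℝ X] {S : ℝ → X →L[ℝ] X}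

theorem IsC0Semigroup.tendsto_Ici (hS : IsC0Semigroup S) (x : X) :
    Tendsto (fun r => S r x) (𝓝[≥] 0) (𝓝 x) := by
  rw [← Ioi_insert, nhdsWithin_insert, tendsto_sup]
  refine ⟨?_, hS.tendsto x⟩
  have : S 0 x = x := by rw [hS.zero]; rfl
  simpa [this] using tendsto_pure_nhds (fun r => S r x) (0 : ℝ)

/-- Otherwise there are `t n → 0` with `‖S (t n)‖ > n`, while every orbit `S (t n) x` converges and
is therefore bounded, contradicting the uniform boundedness principle. -/
theorem IsC0Semigroup.exists_bound_near_zero [CompleteSpace X] (hS : IsC0Semigroup S) :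
    ∃ δ > 0, ∃ C : ℝ, ∀ t ∈ Icc 0 δ, ‖S t‖ ≤ C := by
  by_contra! hcon
  have h1 : ∀ n : ℕ, ∃ t ∈ Icc (0 : ℝ) (1 / ((n : ℝ) + 1)), (n : ℝ) < ‖S t‖ := fun n =>
    hcon _ (by positivity) n
  choose t ht htn using h1
  have ht0 : Tendsto t atTop (𝓝[≥] 0) := by
    refine tendsto_nhdsWithin_iff.2 ⟨?_, Eventually.of_forall fun n => (ht n).1⟩
    exact squeeze_zero (fun n => (ht n).1) (fun n => (ht n).2)
      tendsto_one_div_add_atTop_nhds_zero_nat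
  obtain ⟨C, hC⟩ := banach_steinhaus (g := fun n => S (t n)) fun x => by
    obtain ⟨C, hC⟩ := ((hS.tendsto_Ici x).comp ht0).norm.bddAbove_range
    exact ⟨C, fun n => hC ⟨n, rfl⟩⟩
  obtain ⟨n, hn⟩ := exists_nat_gt C
  exact (hn.trans (htn n)).not_ge (hC n)

theorem IsC0Semigroup.exists_bound [CompleteSpace X] (hS : IsC0Semigroup S) (T : ℝ) :
    ∃ C : ℝ, 0 ≤ C ∧ ∀ t ∈ Icc 0 T, ‖S t‖ ≤ C := by
  obtain ⟨δ, hδ, C₀, hC₀⟩ := hS.exists_bound_near_zero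
  have hC₀0 : 0 ≤ C₀ := (norm_nonneg _).trans (hC₀ 0 ⟨le_rfl, hδ.le⟩)
  have key : ∀ n : ℕ, ∃ C : ℝ, 0 ≤ C ∧ ∀ t ∈ Icc 0 (n * δ), ‖S t‖ ≤ C := by
    intro n
    induction n with
    | zero =>
      refine ⟨C₀, hC₀0, fun t ht => hC₀ t ⟨ht.1, ht.2.trans ?_⟩⟩
      simpa using hδ.le
    | succ n ih =>
      obtain ⟨C, hC0, hC⟩ := ih
      refine ⟨max C₀ (C₀ * C), le_max_of_le_left hC₀0, fun t ht => ?_⟩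
      rcases le_total t δ with h | h
      · exact (hC₀ t ⟨ht.1, h⟩).trans (le_max_left _ _)
      · have h2 : t - δ ∈ Icc 0 (n * δ) := by
          refine ⟨by linarith, ?_⟩
          have := ht.2
          push_cast at this
          linarith
        have h3 : S t = (S δ).comp (S (t - δ)) := by
          rw [← hS.add δ (t - δ) hδ.le h2.1]; congr 1; ring
        rw [h3]
        refine (ContinuousLinearMap.opNorm_comp_le _ _).trans (le_trans ?_ (le_max_right _ _))
        exact mul_le_mul (hC₀ δ ⟨hδ.le, le_rfl⟩) (hC _ h2) (norm_nonneg _) hC₀0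
  obtain ⟨n, hn⟩ := exists_nat_ge (T / δ)
  obtain ⟨C, hC0, hC⟩ := key n
  exact ⟨C, hC0, fun t ht => hC t ⟨ht.1, ht.2.trans ((div_le_iff₀ hδ).1 hn)⟩⟩

theorem IsC0Semigroup.norm_sub_le (hS : IsC0Semigroup S) {T C : ℝ}
    (hC : ∀ t ∈ Icc 0 T, ‖S t‖ ≤ C) {s t : ℝ} (hs : s ∈ Icc 0 T) (ht : t ∈ Icc 0 T) (x : X) :
    ‖S t x - S s x‖ ≤ C * ‖S |t - s| x - x‖ := by
  have aux : ∀ a b : ℝ, a ∈ Icc 0 T → a ≤ b → ‖S b x - S a x‖ ≤ C * ‖S (b - a) x - x‖ := by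
    intro a b ha hab
    have h : S b x - S a x = S a (S (b - a) x - x) := by
      have h3 : S b = (S a).comp (S (b - a)) := by
        rw [← hS.add a (b - a) ha.1 (by linarith)]; congr 1; ring
      rw [h3]; simp
    rw [h]
    exact ((S a).le_opNorm _).trans (mul_le_mul_of_nonneg_right (hC a ha) (norm_nonneg _))
  rcases le_total s t with h | h
  · rw [abs_of_nonneg (by linarith)]
    exact aux s t hs h
  · rw [abs_of_nonpos (by linarith), norm_sub_rev, neg_sub]
    exact aux t s ht h

theorem IsC0Semigroup.tendsto_abs (hS : IsC0Semigroup S) (x : X) :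
    Tendsto (fun r => S |r| x) (𝓝 0) (𝓝 x) := by
  refine (hS.tendsto_Ici x).comp (tendsto_nhdsWithin_iff.2 ⟨?_, Eventually.of_forall fun r => abs_nonneg r⟩)
  simpa using (continuous_abs.tendsto (0 : ℝ))

/-- Local boundedness upgrades strong right continuity at `0` to joint continuity. Truncating time
at `0` is needed because `S` is arbitrary at negative times; it also makes the convolution
integrands below measurable without case distinctions. -/
theorem IsC0Semigroup.continuous_uncurry [CompleteSpace X] (hS : IsC0Semigroup S) :
    Continuous fun p : ℝ × X => S (max p.1 0) p.2 := by
  rw [continuous_iff_continuousAt]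
  rintro ⟨a, x⟩
  obtain ⟨C, hC0, hC⟩ := hS.exists_bound (|a| + 1)
  rw [ContinuousAt, tendsto_iff_norm_sub_tendsto_zero]
  have hlim : Tendsto (fun p : ℝ × X => C * ‖p.2 - x‖ +
      C * ‖S |max p.1 0 - max a 0| x - x‖) (𝓝 (a, x)) (𝓝 0) := by
    have h1 : Tendsto (fun p : ℝ × X => C * ‖p.2 - x‖) (𝓝 (a, x)) (𝓝 0) := by
      have : Continuous fun p : ℝ × X => C * ‖p.2 - x‖ := by fun_prop
      simpa using this.tendsto (a, x)
    have h2 : Tendsto (fun p : ℝ × X => max p.1 0 - max a 0) (𝓝 (a, x)) (𝓝 0) := by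
      have : Continuous fun p : ℝ × X => max p.1 0 - max a 0 := by fun_prop
      simpa using this.tendsto (a, x)
    have h3 := (((hS.tendsto_abs x).comp h2).sub_const x).norm.const_mul C
    simpa using h1.add h3
  refine squeeze_zero' (Eventually.of_forall fun _ => norm_nonneg _) ?_ hlim
  have hev : ∀ᶠ p : ℝ × X in 𝓝 (a, x), p.1 < |a| + 1 :=
    continuous_fst.continuousAt.eventually_lt continuousAt_const (by
      change a < _
      linarith [le_abs_self a])
  filter_upwards [hev] with p hp
  have hp1 : max p.1 0 ∈ Icc 0 (|a| + 1) := ⟨le_max_right _ _, max_le hp.le (by positivity)⟩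
  have ha1 : max a 0 ∈ Icc 0 (|a| + 1) :=
    ⟨le_max_right _ _, max_le (by linarith [le_abs_self a]) (by positivity)⟩
  have e : S (max p.1 0) p.2 - S (max a 0) x =
      S (max p.1 0) (p.2 - x) + (S (max p.1 0) x - S (max a 0) x) := by simp
  rw [e]
  refine (norm_add_le _ _).trans (add_le_add ?_ (hS.norm_sub_le hC ha1 hp1 x))
  exact ((S _).le_opNorm _).trans (mul_le_mul_of_nonneg_right (hC _ hp1) (norm_nonneg _))

variable {L : X → X → Prop}

theorem IsGenerator.semigroup_apply (hS : IsC0Semigroup S) (hL : IsGenerator S L) {x y : X}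
    (hxy : L x y) {t : ℝ} (ht : 0 ≤ t) : L (S t x) (S t y) := by
  rw [hL] at hxy ⊢
  refine (((S t).continuous.tendsto y).comp hxy).congr' ?_
  filter_upwards [self_mem_nhdsWithin] with h hh
  have h1 : S h (S t x) = S t (S h x) := by
    have e1 := hS.add h t (le_of_lt hh) ht
    have e2 := hS.add t h ht (le_of_lt hh)
    rw [add_comm, e2] at e1
    exact (DFunLike.congr_fun e1 x).symm
  simp [h1]

theorem IsGenerator.hasDerivWithinAt (hS : IsC0Semigroup S) (hL : IsGenerator S L) {x y : X}
    (hxy : L x y) {t : ℝ} (ht : 0 ≤ t) :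
    HasDerivWithinAt (fun r => S r x) (S t y) (Ioi t) t := by
  rw [hasDerivWithinAt_iff_tendsto_slope' (by simp)]
  have h1 := (hL _ _).1 (hL.semigroup_apply hS hxy ht)
  have h2 : Tendsto (fun r => r - t) (𝓝[>] t) (𝓝[>] 0) := by
    refine tendsto_nhdsWithin_iff.2 ⟨?_, ?_⟩
    · have : Continuous fun r : ℝ => r - t := by fun_prop
      simpa using (this.tendsto t).mono_left nhdsWithin_le_nhds
    · filter_upwards [self_mem_nhdsWithin] with r hr
      simpa using hr
  refine (h1.comp h2).congr' ?_
  filter_upwards [self_mem_nhdsWithin] with r hr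
  have hr' : t < r := hr
  have e1 := hS.add (r - t) t (by linarith) ht
  rw [sub_add_cancel] at e1
  simp [slope_def_module, e1]

/-- `S ε` shifts the interval of integration from `[0, h]` to `[ε, h + ε]`, so the difference
quotient is the average of the orbit over `[h, h + ε]` minus that over `[0, ε]`, and the averages
converge to the endpoint values. -/
theorem IsGenerator.integral_mem [CompleteSpace X] (hS : IsC0Semigroup S) (hL : IsGenerator S L)
    (x : X) {h : ℝ} (hh : 0 ≤ h) : L (∫ r in (0 : ℝ)..h, S (max r 0) x) (S h x - x) := by
  rw [hL]
  have hc : Continuous fun r => S (max r 0) x :=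
    hS.continuous_uncurry.comp (continuous_id.prodMk continuous_const)
  have hd : ∀ a, 0 ≤ a →
      Tendsto (fun ε : ℝ => ε⁻¹ • ∫ r in a..a + ε, S (max r 0) x) (𝓝[>] 0) (𝓝 (S a x)) := by
    intro a ha
    have h1 := (intervalIntegral.integral_hasDerivAt_right (hc.intervalIntegrable a a)
      hc.stronglyMeasurable.stronglyMeasurableAtFilter hc.continuousAt).tendsto_slope_zero_right
    simpa [max_eq_left ha] using h1
  have h0 := hd 0 le_rfl
  have e0 : S 0 x = x := by rw [hS.zero]; rfl
  rw [e0] at h0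
  refine ((hd h hh).sub h0).congr' ?_
  filter_upwards [self_mem_nhdsWithin] with ε hε
  have hε' : 0 < ε := hε
  rw [← smul_sub]
  congr 1
  rw [← ContinuousLinearMap.intervalIntegral_comp_comm _ (hc.intervalIntegrable _ _)]
  have e1 : ∫ r in (0 : ℝ)..h, S ε (S (max r 0) x) = ∫ r in ε..h + ε, S (max r 0) x := by
    have e2 : ∫ r in (0 : ℝ)..h, S ε (S (max r 0) x) =
        ∫ r in (0 : ℝ)..h, S (max (r + ε) 0) x := by
      refine intervalIntegral.integral_congr fun r hr => ?_
      rw [uIcc_of_le hh] at hr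
      have e3 := hS.add ε r hε'.le hr.1
      rw [max_eq_left hr.1, max_eq_left (by linarith [hr.1]), add_comm r ε, e3]
      rfl
    rw [e2, intervalIntegral.integral_comp_add_right (fun r => S (max r 0) x)]
    simp
  rw [e1]
  have i := fun a b => hc.intervalIntegrable (μ := volume) a b
  have j1 := intervalIntegral.integral_add_adjacent_intervals (i 0 ε) (i ε (h + ε))
  have j2 := intervalIntegral.integral_add_adjacent_intervals (i 0 h) (i h (h + ε))
  rw [zero_add]
  rw [← j2] at j1
  rw [sub_eq_sub_iff_add_eq_add, add_comm _ (∫ r in (0 : ℝ)..ε, _), j1, add_comm]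

/-- The averages `ε⁻¹ ∫_0^ε S r x dr` lie in the domain and converge to `x`. -/
theorem IsGenerator.dense_domain [CompleteSpace X] (hS : IsC0Semigroup S) (hL : IsGenerator S L) :
    Dense {x | ∃ y, L x y} := by
  intro x
  have hc : Continuous fun r => S (max r 0) x :=
    hS.continuous_uncurry.comp (continuous_id.prodMk continuous_const)
  have h1 := (intervalIntegral.integral_hasDerivAt_right (hc.intervalIntegrable 0 0)
      hc.stronglyMeasurable.stronglyMeasurableAtFilter hc.continuousAt).tendsto_slope_zero_right
  have e0 : S 0 x = x := by rw [hS.zero]; rfl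
  simp only [zero_add, intervalIntegral.integral_same, sub_zero, max_self, e0] at h1
  refine mem_closure_of_tendsto h1 ?_
  filter_upwards [self_mem_nhdsWithin] with ε hε
  refine ⟨ε⁻¹ • (S ε x - x), ?_⟩
  have h2 := (hL _ _).1 (hL.integral_mem hS x (le_of_lt hε))
  rw [hL]
  refine (h2.const_smul ε⁻¹).congr fun r => ?_
  rw [map_smul, ← smul_sub, smul_comm]

end Semigroups

/-! ### Adjoint families and their pairing with mild solutions -/

section Duality

variable {X : Type*} [NormedAddCommGroup X] [NormedSpace ℝ X] {S : ℝ → X →L[ℝ] X}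
  {L : X → X → Prop}

/-- A bounded, pointwise differentiable family of functionals `ℓ σ`, `σ ∈ ℝ`, such that
`ℓ σ (L x) + ℓ' σ x = c σ * m x` on the domain of `L` for `σ ∈ [0, t)`. -/
structure IsAdjointFamily (L : X → X → Prop) (t : ℝ) (ℓ ℓ' : ℝ → X →L[ℝ] ℝ) (c : ℝ → ℝ)
    (m : X →L[ℝ] ℝ) : Prop where
  bounded : ∃ C, ∀ σ, ‖ℓ σ‖ ≤ C
  hasDerivAt : ∀ x σ, HasDerivAt (fun τ => ℓ τ x) (ℓ' σ x) σ
  continuous_coeff : Continuous c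
  apply_add : ∀ σ ∈ Ico 0 t, ∀ x y, L x y → ℓ σ y + ℓ' σ x = c σ * m x

variable {t : ℝ} {ℓ ℓ' : ℝ → X →L[ℝ] ℝ} {c : ℝ → ℝ} {m : X →L[ℝ] ℝ}

theorem IsAdjointFamily.continuous_uncurry (h : IsAdjointFamily L t ℓ ℓ' c m) :
    Continuous fun p : ℝ × X => ℓ p.1 p.2 := by
  obtain ⟨C, hC⟩ := h.bounded
  rw [continuous_iff_continuousAt]
  rintro ⟨a, x⟩
  rw [ContinuousAt, tendsto_iff_norm_sub_tendsto_zero]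
  have hlim : Tendsto (fun p : ℝ × X => C * ‖p.2 - x‖ + ‖ℓ p.1 x - ℓ a x‖)
      (𝓝 (a, x)) (𝓝 0) := by
    have hc : Continuous fun τ => ℓ τ x :=
      continuous_iff_continuousAt.2 fun σ => (h.hasDerivAt x σ).continuousAt
    have : Continuous fun p : ℝ × X => C * ‖p.2 - x‖ + ‖ℓ p.1 x - ℓ a x‖ := by
      have := hc.comp (continuous_fst (X := ℝ) (Y := X))
      simp only [Function.comp_def] at this
      fun_prop
    simpa using this.tendsto (a, x)
  refine squeeze_zero (fun _ => norm_nonneg _) (fun p => ?_) hlim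
  have e : ℓ p.1 p.2 - ℓ a x = ℓ p.1 (p.2 - x) + (ℓ p.1 x - ℓ a x) := by simp
  rw [e]
  refine (norm_add_le _ _).trans (add_le_add ?_ le_rfl)
  exact ((ℓ p.1).le_opNorm _).trans (mul_le_mul_of_nonneg_right (hC _) (norm_nonneg _))

/-- A product rule when `ℓ` is only pointwise differentiable: the slope splits into `ℓ τ` applied to
the slope of `x`, handled by joint continuity, and the slope of `ℓ` at the fixed vector `x σ`. -/
theorem IsAdjointFamily.hasDerivWithinAt_comp (h : IsAdjointFamily L t ℓ ℓ' c m) {x : ℝ → X}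
    {y : X} {σ : ℝ} (hx : HasDerivWithinAt x y (Ioi σ) σ) :
    HasDerivWithinAt (fun τ => ℓ τ (x τ)) (ℓ σ y + ℓ' σ (x σ)) (Ioi σ) σ := by
  rw [hasDerivWithinAt_iff_tendsto_slope' (by simp)] at hx ⊢
  have h1 := (h.hasDerivAt (x σ) σ).hasDerivWithinAt (s := Ioi σ)
  rw [hasDerivWithinAt_iff_tendsto_slope' (by simp)] at h1
  have h2 : Tendsto (fun τ => (τ, slope x σ τ)) (𝓝[>] σ) (𝓝 (σ, y)) :=
    (tendsto_id.mono_left nhdsWithin_le_nhds).prodMk_nhds hx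
  refine (((h.continuous_uncurry.tendsto (σ, y)).comp h2).add h1).congr fun τ => ?_
  simp only [Function.comp_apply, slope_def_module, map_smul, map_sub, ← smul_add]
  congr 1
  ring

/-- For `x` in the domain, `τ ↦ ℓ τ (S (τ - r) x)` has right derivative `c τ * m (S (τ - r) x)`,
which is then integrated. The resulting identity no longer mentions the generator, and both sides
are continuous in `x`, so density extends it to all `x`. -/
theorem IsAdjointFamily.apply_semigroup [CompleteSpace X] (h : IsAdjointFamily L t ℓ ℓ' c m)
    (hS : IsC0Semigroup S) (hL : IsGenerator S L) {r : ℝ} (hr : r ∈ Icc 0 t) (x : X) :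
    ℓ t (S (t - r) x) =
      ℓ r x + ∫ τ in r..t, c τ * m (S (max (τ - r) 0) x) := by
  have hjoint : Continuous fun p : X × ℝ => c p.2 * m (S (max (p.2 - r) 0) p.1) := by
    have h1 : Continuous fun p : X × ℝ => S (max (p.2 - r) 0) p.1 :=
      hS.continuous_uncurry.comp ((continuous_snd.sub continuous_const).prodMk continuous_fst)
    exact (h.continuous_coeff.comp continuous_snd).mul (m.continuous.comp h1)
  refine congr_fun (Continuous.ext_on (hL.dense_domain hS)
    (f := fun x => ℓ t (S (t - r) x))
    (g := fun x => ℓ r x + ∫ τ in r..t, c τ * m (S (max (τ - r) 0) x)) (by fun_prop) ?_ ?_) x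
  · exact (ℓ r).continuous.add
      (intervalIntegral.continuous_parametric_intervalIntegral_of_continuous' hjoint r t)
  rintro x ⟨y, hxy⟩
  have hx : Continuous fun τ => S (max (τ - r) 0) x :=
    hS.continuous_uncurry.comp ((continuous_id.sub continuous_const).prodMk continuous_const)
  have key := intervalIntegral.integral_eq_sub_of_hasDeriv_right (a := r) (b := t)
    (f := fun τ => ℓ τ (S (max (τ - r) 0) x)) (f' := fun τ => c τ * m (S (max (τ - r) 0) x))
    (h.continuous_uncurry.comp (continuous_id.prodMk hx)).continuousOn ?_
    ((hjoint.comp (continuous_const.prodMk continuous_id)).intervalIntegrable r t)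
  · simp only [key, sub_self, max_self, max_eq_left (sub_nonneg.2 hr.2)]
    have : S 0 x = x := by rw [hS.zero]; rfl
    rw [this]; ring
  · intro σ hσ
    rw [min_eq_left hr.2, max_eq_right hr.2] at hσ
    have hσr : 0 ≤ σ - r := sub_nonneg.2 hσ.1.le
    have hd := hL.hasDerivWithinAt hS hxy hσr
    have hd2 : HasDerivWithinAt (fun τ => S (max (τ - r) 0) x) (S (σ - r) y) (Ioi σ) σ := by
      have h3 : HasDerivWithinAt (fun τ => τ - r) 1 (Ioi σ) σ :=
        ((hasDerivAt_id σ).sub_const r).hasDerivWithinAt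
      have h4 := hd.scomp (t' := Ioi (σ - r)) σ h3 fun τ hτ => by
        have : σ < τ := hτ
        simpa using this
      rw [one_smul] at h4
      refine h4.congr (fun τ hτ => ?_) ?_
      · have : σ < τ := hτ
        simp [max_eq_left (by linarith : 0 ≤ τ - r)]
      · simp [max_eq_left hσr]
    have h5 := h.hasDerivWithinAt_comp hd2
    rw [max_eq_left hσr, h.apply_add σ ⟨hr.1.trans hσ.1.le, hσ.2⟩ _ _
      (hL.semigroup_apply hS hxy hσr)] at h5
    simpa only [max_eq_left hσr] using h5

/-- The pairing of a mild solution with an adjoint family that annihilates the nonlinearity. -/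
theorem IsMildSolution.pairing [CompleteSpace X] {f : X → X} {T : ℝ} {U₀ : X} {U : ℝ → X}
    (hU : IsMildSolution L f T U₀ U) (ht : t ∈ Icc 0 T) (h : IsAdjointFamily L t ℓ ℓ' c m)
    (hf : ∀ σ x, ℓ σ (f x) = 0) :
    ℓ t (U t) - ℓ 0 U₀ = ∫ τ in (0 : ℝ)..t, c τ * m (U τ) := by
  obtain ⟨S, hS, hL, hUc, hfi, hUeq⟩ := hU
  obtain ⟨C, hC0, hC⟩ := hS.exists_bound T
  have hfi' : IntegrableOn (fun τ => f (U τ)) (Ioc 0 t) :=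
    hfi.mono_set fun r hr => ⟨hr.1.le, hr.2.trans ht.2⟩
  have hmeas : ∀ a, AEStronglyMeasurable (fun r => S (max (a - r) 0) (f (U r)))
      (volume.restrict (Ioc 0 t)) := fun a =>
    hS.continuous_uncurry.comp_aestronglyMeasurable
      ((continuous_const.sub continuous_id).aestronglyMeasurable.prodMk
        hfi'.aestronglyMeasurable)
  have hbound : ∀ a ∈ Icc 0 t, ∀ r ∈ Ioc 0 t,
      ‖S (max (a - r) 0) (f (U r))‖ ≤ C * ‖f (U r)‖ := fun a ha r hr =>
    ((S _).le_opNorm _).trans (mul_le_mul_of_nonneg_right (hC _ ⟨le_max_right _ _,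
      max_le (by linarith [ha.2, hr.1, ht.2]) (ht.1.trans ht.2)⟩) (norm_nonneg _))
  have hint : ∀ a ∈ Icc 0 t, IntegrableOn (fun r => S (max (a - r) 0) (f (U r))) (Ioc 0 t) :=
    fun a ha => (hfi'.norm.const_mul C).mono' (hmeas a)
      ((ae_restrict_iff' measurableSet_Ioc).2 (Eventually.of_forall (hbound a ha)))
  have hU' : ∀ a ∈ Icc 0 t, U a = S a U₀ + ∫ r in Ioc 0 a, S (max (a - r) 0) (f (U r)) := by
    intro a ha
    rw [hUeq a ⟨ha.1, ha.2.trans ht.2⟩, intervalIntegral.integral_of_le ha.1]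
    congr 1
    refine setIntegral_congr_fun measurableSet_Ioc fun r hr => ?_
    rw [max_eq_left (sub_nonneg.2 hr.2)]
  have htt : t ∈ Icc 0 t := ⟨ht.1, le_rfl⟩
  -- The double integral runs over the triangle `r < τ ≤ t`; the indicator makes the domain a
  -- square, so that Fubini applies.
  set K : ℝ → ℝ → ℝ := fun r τ =>
    (Ioc r t).indicator (fun τ => c τ * m (S (max (τ - r) 0) (f (U r)))) τ with hK
  obtain ⟨B, hB⟩ := isCompact_Icc.exists_bound_of_continuousOn
    (h.continuous_coeff.continuousOn (s := Icc 0 t))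
  have hKint : Integrable (Function.uncurry K)
      ((volume.restrict (Ioc 0 t)).prod (volume.restrict (Ioc 0 t))) := by
    have hm : AEStronglyMeasurable
        (fun z : ℝ × ℝ => c z.2 * m (S (max (z.2 - z.1) 0) (f (U z.1))))
        ((volume.restrict (Ioc 0 t)).prod (volume.restrict (Ioc 0 t))) := by
      refine (h.continuous_coeff.comp continuous_snd).aestronglyMeasurable.mul
        (m.continuous.comp_aestronglyMeasurable ?_)
      exact hS.continuous_uncurry.comp_aestronglyMeasurable
        ((continuous_snd.sub continuous_fst).aestronglyMeasurable.prodMk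
          hfi'.aestronglyMeasurable.comp_fst)
    have hset : MeasurableSet {z : ℝ × ℝ | z.2 ∈ Ioc z.1 t} :=
      (measurableSet_lt measurable_fst measurable_snd).inter
        (measurableSet_le measurable_snd measurable_const)
    have hKe : Function.uncurry K = {z : ℝ × ℝ | z.2 ∈ Ioc z.1 t}.indicator
        (fun z : ℝ × ℝ => c z.2 * m (S (max (z.2 - z.1) 0) (f (U z.1)))) := rfl
    rw [hKe]
    refine ((hfi'.norm.const_mul (B * (‖m‖ * C))).comp_fst _).mono' (hm.indicator hset) ?_
    rw [Measure.prod_restrict, ae_restrict_iff' (measurableSet_Ioc.prod measurableSet_Ioc)]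
    refine Eventually.of_forall fun z hz => (norm_indicator_le_norm_self _ _).trans ?_
    have hz2 : z.2 ∈ Icc 0 t := Ioc_subset_Icc_self hz.2
    rw [norm_mul, mul_assoc, mul_assoc]
    refine mul_le_mul (hB _ hz2) ?_ (norm_nonneg _) ((norm_nonneg _).trans (hB _ hz2))
    exact (m.le_opNorm _).trans
      (mul_le_mul_of_nonneg_left (hbound _ hz2 _ hz.1) (norm_nonneg _))
  have e1 : ℓ t (∫ r in Ioc 0 t, S (max (t - r) 0) (f (U r))) =
      ∫ τ in Ioc 0 t, c τ * m (∫ r in Ioc 0 τ, S (max (τ - r) 0) (f (U r))) := by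
    rw [← ContinuousLinearMap.integral_comp_comm _ (hint t htt)]
    -- The orbit started at time `r` from `f (U r)` contributes no initial term, since `ℓ r`
    -- annihilates the range of `f`.
    have e2 : ∀ r ∈ Ioc 0 t, ℓ t (S (max (t - r) 0) (f (U r))) = ∫ τ in Ioc 0 t, K r τ := by
      intro r hr
      rw [max_eq_left (sub_nonneg.2 hr.2), h.apply_semigroup hS hL ⟨hr.1.le, hr.2⟩, hf, zero_add,
        intervalIntegral.integral_of_le hr.2, hK, setIntegral_indicator measurableSet_Ioc]
      congr 2
      ext τ
      simp only [mem_inter_iff, mem_Ioc]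
      exact ⟨fun hτ => ⟨⟨hr.1.trans hτ.1, hτ.2⟩, hτ⟩, fun hτ => hτ.2⟩
    rw [setIntegral_congr_fun measurableSet_Ioc e2, integral_integral_swap hKint]
    refine setIntegral_congr_fun measurableSet_Ioc fun τ hτ => ?_
    have hτ' : τ ∈ Icc 0 t := Ioc_subset_Icc_self hτ
    have hint' : IntegrableOn (fun r => S (max (τ - r) 0) (f (U r))) (Ioc 0 τ) :=
      (hint τ hτ').mono_set (Ioc_subset_Ioc_right hτ.2)
    -- The diagonal point `r = τ` is dropped, because the indicator in `K` is strict in `r < τ`.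
    rw [← ContinuousLinearMap.integral_comp_comm _ hint', ← integral_const_mul,
      integral_Ioc_eq_integral_Ioo (y := τ), ← inter_eq_right.2 (Ioo_subset_Ioc_self.trans
        (Ioc_subset_Ioc_right hτ.2)), ← setIntegral_indicator measurableSet_Ioo]
    refine setIntegral_congr_fun measurableSet_Ioc fun r hr => ?_
    by_cases hrτ : r < τ
    · rw [hK]
      simp only
      rw [indicator_of_mem (show τ ∈ Ioc r t from ⟨hrτ, hτ.2⟩),
        indicator_of_mem (show r ∈ Ioo 0 τ from ⟨hr.1, hrτ⟩)]
    · rw [hK]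
      simp only
      rw [indicator_of_notMem (fun hh => hrτ hh.1), indicator_of_notMem (fun hh => hrτ hh.2)]
  have hcS : ContinuousOn (fun τ => c τ * m (S τ U₀)) (Icc 0 t) := by
    have hx : Continuous fun τ => c τ * m (S (max τ 0) U₀) :=
      h.continuous_coeff.mul (m.continuous.comp
        (hS.continuous_uncurry.comp (continuous_id.prodMk continuous_const)))
    exact hx.continuousOn.congr fun τ hτ => by
      simp only [max_eq_left hτ.1]
  have hcU : ContinuousOn (fun τ => c τ * m (U τ)) (Icc 0 t) :=
    h.continuous_coeff.continuousOn.mul (m.continuous.comp_continuousOn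
      (hUc.mono (Icc_subset_Icc_right ht.2)))
  -- Duhamel's formula at the intermediate time `τ` expresses the inner convolution as `U τ - S τ
  -- U₀`; the orbit term then cancels against `e4`.
  have e3 : ∫ τ in Ioc 0 t, c τ * m (∫ r in Ioc 0 τ, S (max (τ - r) 0) (f (U r))) =
      (∫ τ in Ioc 0 t, c τ * m (U τ)) - ∫ τ in Ioc 0 t, c τ * m (S τ U₀) := by
    rw [← integral_sub (hcU.integrableOn_Icc.mono_set Ioc_subset_Icc_self)
      (hcS.integrableOn_Icc.mono_set Ioc_subset_Icc_self)]
    refine setIntegral_congr_fun measurableSet_Ioc fun τ hτ => ?_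
    rw [hU' τ (Ioc_subset_Icc_self hτ), map_add]
    ring
  have e4 := h.apply_semigroup hS hL (r := 0) ⟨le_rfl, ht.1⟩ U₀
  rw [sub_zero, intervalIntegral.integral_of_le ht.1] at e4
  have e5 : ∫ τ in Ioc 0 t, c τ * m (S (max (τ - 0) 0) U₀) =
      ∫ τ in Ioc 0 t, c τ * m (S τ U₀) :=
    setIntegral_congr_fun measurableSet_Ioc fun τ hτ => by
      rw [sub_zero, max_eq_left hτ.1.le]
  rw [hU' t htt, map_add, e4, e1, e3, e5, intervalIntegral.integral_of_le ht.1]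
  ring

end Duality

/-! ### Monotone kernels and the weighted memory space -/

section Kernel

variable {μ : ℝ → ℝ} {δ : ℝ}

theorem IsMemoryKernel.antitoneOn (hμ : IsMemoryKernel μ δ) (hδ : 0 < δ) :
    AntitoneOn μ (Ici 0) := by
  refine antitoneOn_of_deriv_nonpos (convex_Ici 0) hμ.continuousOn ?_ ?_
  · rw [interior_Ici]
    exact hμ.contDiffOn.differentiableOn (by norm_num)
  · intro s hs
    rw [interior_Ici] at hs
    have := hμ.decay s hs
    have := mul_nonneg hδ.le (hμ.nonneg s hs)
    linarith

theorem IsMemoryKernel.isOpen_pos (hμ : IsMemoryKernel μ δ) : IsOpen {s | 0 < s ∧ 0 < μ s} :=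
  (hμ.continuousOn.mono Ioi_subset_Ici_self).isOpen_inter_preimage isOpen_Ioi isOpen_Ioi

theorem IsMemoryKernel.ae_weight_iff (hμ : IsMemoryKernel μ δ) {p : ℝ → Prop} :
    (∀ᵐ s ∂weight μ, p s) ↔ ∀ᵐ s, s ∈ {s | 0 < s ∧ 0 < μ s} → p s := by
  have hm : AEMeasurable (fun s => ENNReal.ofReal (μ s)) (volume.restrict (Ioi 0)) :=
    ((hμ.continuousOn.mono Ioi_subset_Ici_self).aemeasurable measurableSet_Ioi).ennreal_ofReal
  rw [weight, ae_withDensity_iff' hm, ae_restrict_iff' measurableSet_Ioi]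
  refine eventually_congr (Eventually.of_forall fun s => ?_)
  simp only [ne_eq, ENNReal.ofReal_eq_zero, not_le, mem_Ioi, mem_ofPred_eq, and_imp]

/-- As `μ` is nonincreasing, `μ ≥ μ b` on `(0, b)`. Hence almost-everywhere statements and
integrability pass from the weighted measure to Lebesgue measure on `(0, b)`. -/
theorem IsMemoryKernel.restrict_le (hμ : IsMemoryKernel μ δ) (hδ : 0 < δ) {b : ℝ} (hb : 0 < b)
    (hμb : 0 < μ b) :
    volume.restrict (Ioo 0 b) ≤ (ENNReal.ofReal (μ b))⁻¹ • weight μ := by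
  have h0 : ENNReal.ofReal (μ b) ≠ 0 := by simpa using hμb
  have h1 : ENNReal.ofReal (μ b) • volume.restrict (Ioo 0 b) ≤ weight μ := by
    calc ENNReal.ofReal (μ b) • volume.restrict (Ioo 0 b)
        = (volume.restrict (Ioo 0 b)).withDensity (fun _ => ENNReal.ofReal (μ b)) :=
          (withDensity_const _).symm
      _ ≤ (volume.restrict (Ioo 0 b)).withDensity (fun s => ENNReal.ofReal (μ s)) := by
          refine withDensity_mono ((ae_restrict_iff' measurableSet_Ioo).2
            (Eventually.of_forall fun s hs => ?_))
          exact ENNReal.ofReal_le_ofReal (hμ.antitoneOn hδ hs.1.le hb.le hs.2.le)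
      _ = (weight μ).restrict (Ioo 0 b) := by
          rw [weight, restrict_withDensity measurableSet_Ioo,
            Measure.restrict_restrict_of_subset Ioo_subset_Ioi_self]
      _ ≤ weight μ := Measure.restrict_le_self
  calc volume.restrict (Ioo 0 b)
      = (ENNReal.ofReal (μ b))⁻¹ • ENNReal.ofReal (μ b) • volume.restrict (Ioo 0 b) := by
        rw [smul_smul, ENNReal.inv_mul_cancel h0 ENNReal.ofReal_ne_top, one_smul]
    _ ≤ _ := by gcongr

theorem IsMemoryKernel.ae_restrict (hμ : IsMemoryKernel μ δ) (hδ : 0 < δ) {b : ℝ} (hb : 0 < b)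
    (hμb : 0 < μ b) {p : ℝ → Prop} (hp : ∀ᵐ s ∂weight μ, p s) :
    ∀ᵐ s ∂volume.restrict (Ioo 0 b), p s :=
  (Measure.absolutelyContinuous_of_le_smul (hμ.restrict_le hδ hb hμb)) hp

variable {E : Type*} [NormedAddCommGroup E]

theorem IsMemoryKernel.exists_integral_norm_le (hμ : IsMemoryKernel μ δ) (hδ : 0 < δ) {b : ℝ}
    (hb : 0 < b) (hμb : 0 < μ b) :
    ∃ C : ℝ, ∀ η : MemorySpace μ E, IntegrableOn η (Ioo 0 b) ∧
      ∫ s in Ioo 0 b, ‖η s‖ ≤ C * ‖η‖ := by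
  have hle := hμ.restrict_le hδ hb hμb
  have hc : (ENNReal.ofReal (μ b))⁻¹ ≠ ∞ := by simpa using hμb
  -- The constant is `(b / μ b)^(1/2)`: Cauchy–Schwarz on `(0, b)` combined with the comparison of
  -- measures.
  set K : ℝ≥0∞ := (ENNReal.ofReal (μ b))⁻¹ ^ (1 / (2 : ℝ≥0∞).toReal) *
    (volume.restrict (Ioo 0 b)) univ ^ (1 / (1 : ℝ≥0∞).toReal - 1 / (2 : ℝ≥0∞).toReal) with hK
  have hKtop : K ≠ ∞ := by
    refine ENNReal.mul_ne_top (ENNReal.rpow_ne_top_of_nonneg (by positivity) hc)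
      (ENNReal.rpow_ne_top_of_nonneg (by norm_num) (measure_ne_top _ _))
  refine ⟨K.toReal, fun η => ?_⟩
  have h2 : MemLp η 2 (volume.restrict (Ioo 0 b)) := (Lp.memLp η).of_measure_le_smul hc hle
  have h1 : Integrable η (volume.restrict (Ioo 0 b)) := h2.integrable (by norm_num)
  refine ⟨h1, ?_⟩
  rw [integral_norm_eq_lintegral_enorm h1.aestronglyMeasurable, ← eLpNorm_one_eq_lintegral_enorm,
    Lp.norm_def, ← ENNReal.toReal_mul]
  refine ENNReal.toReal_mono (ENNReal.mul_ne_top hKtop (Lp.eLpNorm_ne_top η)) ?_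
  calc eLpNorm η 1 (volume.restrict (Ioo 0 b))
      ≤ eLpNorm η 2 (volume.restrict (Ioo 0 b)) * (volume.restrict (Ioo 0 b)) univ ^
          (1 / (1 : ℝ≥0∞).toReal - 1 / (2 : ℝ≥0∞).toReal) :=
        eLpNorm_le_eLpNorm_mul_rpow_measure_univ (by norm_num) h1.aestronglyMeasurable
    _ ≤ eLpNorm η 2 ((ENNReal.ofReal (μ b))⁻¹ • weight μ) * (volume.restrict (Ioo 0 b)) univ ^
          (1 / (1 : ℝ≥0∞).toReal - 1 / (2 : ℝ≥0∞).toReal) := by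
        gcongr
    _ = K * eLpNorm η 2 (weight μ) := by
        rw [eLpNorm_smul_measure_of_ne_top (by norm_num), hK, smul_eq_mul]
        simp only [one_div, ENNReal.toReal_inv]
        ring

variable [NormedSpace ℝ E]

/-- The functionals `η ↦ ∫_0^b φ(s) x(η(s)) ds` with bounded continuous `φ`. -/
theorem IsMemoryKernel.exists_testFunctional (hμ : IsMemoryKernel μ δ) (hδ : 0 < δ) {b : ℝ}
    (hb : 0 < b) (hμb : 0 < μ b) (x : E →L[ℝ] ℝ) :
    ∃ C : ℝ, ∀ (φ : ℝ → ℝ) (B : ℝ), Continuous φ → (∀ s, ‖φ s‖ ≤ B) →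
      ∃ Φ : MemorySpace μ E →L[ℝ] ℝ, (∀ η, Φ η = ∫ s in Ioo 0 b, φ s * x (η s)) ∧
        ‖Φ‖ ≤ B * C := by
  obtain ⟨K, hK⟩ := hμ.exists_integral_norm_le (E := E) hδ hb hμb
  -- `K` is not known to be nonnegative, whereas the operator norm bound must be. The constant does
  -- not depend on `φ`, so all shifts of one test function share a bound.
  refine ⟨‖x‖ * max K 0, fun φ B hφ hB => ?_⟩
  have hB0 : 0 ≤ B := (norm_nonneg _).trans (hB 0)
  have hint : ∀ η : MemorySpace μ E, IntegrableOn (fun s => φ s * x (η s)) (Ioo 0 b) := fun η =>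
    (x.integrable_comp (hK η).1).bdd_mul hφ.aestronglyMeasurable (Eventually.of_forall hB)
  let Λ : MemorySpace μ E →ₗ[ℝ] ℝ :=
    { toFun := fun η => ∫ s in Ioo 0 b, φ s * x (η s)
      map_add' := fun η ξ => by
        rw [← integral_add (hint η) (hint ξ)]
        refine integral_congr_ae ?_
        filter_upwards [hμ.ae_restrict hδ hb hμb (Lp.coeFn_add η ξ)] with s hs
        rw [hs, Pi.add_apply, map_add, mul_add]
      map_smul' := fun a η => by
        rw [RingHom.id_apply, smul_eq_mul, ← integral_const_mul]
        refine integral_congr_ae ?_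
        filter_upwards [hμ.ae_restrict hδ hb hμb (Lp.coeFn_smul a η)] with s hs
        rw [hs, Pi.smul_apply, map_smul, smul_eq_mul]
        ring }
  have hΛ : ∀ η, ‖Λ η‖ ≤ B * (‖x‖ * max K 0) * ‖η‖ := fun η => by
    calc ‖Λ η‖ ≤ ∫ s in Ioo 0 b, ‖φ s * x (η s)‖ := norm_integral_le_integral_norm _
      _ ≤ ∫ s in Ioo 0 b, B * ‖x‖ * ‖η s‖ := by
          refine integral_mono (hint η).norm ((hK η).1.norm.const_mul _) fun s => ?_
          simp only [norm_mul, mul_assoc]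
          exact mul_le_mul (hB s) (x.le_opNorm _) (norm_nonneg _) hB0
      _ = B * ‖x‖ * ∫ s in Ioo 0 b, ‖η s‖ := integral_const_mul _ _
      _ ≤ B * ‖x‖ * (max K 0 * ‖η‖) := by
          gcongr
          exact (hK η).2.trans (mul_le_mul_of_nonneg_right (le_max_left _ _) (norm_nonneg _))
      _ = _ := by ring
  exact ⟨Λ.mkContinuous _ hΛ, fun η => rfl,
    LinearMap.mkContinuous_norm_le _ (by positivity) _⟩

end Kernel

/-! ### Integration by parts up to the boundary point zero -/

section Boundary

/-- Integration by parts on `(0, b)` against a weakly differentiable function which vanishes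
at `0`, for a test function which need not vanish near `0`. -/
theorem integral_deriv_mul_of_vanishing {b : ℝ} {h g : ℝ → ℝ}
    (hh : IntegrableOn h (Ioo 0 b)) (hg : IntegrableOn g (Ioo 0 b))
    (hweak : ∀ φ : ℝ → ℝ, ContDiff ℝ (⊤ : ℕ∞) φ → HasCompactSupport φ → tsupport φ ⊆ Ioc 0 b →
      ∫ s in Ioo 0 b, deriv φ s * h s = - ∫ s in Ioo 0 b, φ s * g s)
    (hzero : ∀ ε > 0, ∃ r > 0, ∀ᵐ s, s ∈ Ioo 0 r → |h s| ≤ ε)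
    {ψ : ℝ → ℝ} (hψ : ContDiff ℝ (⊤ : ℕ∞) ψ) (hψb : ∀ s, b < s → ψ s = 0) :
    ∫ s in Ioo 0 b, deriv ψ s * h s = - ∫ s in Ioo 0 b, ψ s * g s := by
  rcases le_or_gt b 0 with hb | hb
  · simp [Ioo_eq_empty_of_le hb]
  set χ := Real.smoothTransition with hχdef
  have hχ : ContDiff ℝ (⊤ : ℕ∞) χ := Real.smoothTransition.contDiff
  have hχ1 : ∀ x, ‖χ x‖ ≤ 1 := fun x => by
    rw [Real.norm_of_nonneg (Real.smoothTransition.nonneg x)]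
    exact Real.smoothTransition.le_one x
  have hχ'c : Continuous (deriv χ) := hχ.continuous_deriv (by simp)
  have hψ'c : Continuous (deriv ψ) := hψ.continuous_deriv (by simp)
  obtain ⟨C, hC⟩ := (isCompact_Icc (a := (0 : ℝ)) (b := 1)).exists_bound_of_continuousOn
    hχ'c.continuousOn
  have hC0 : 0 ≤ C := (norm_nonneg _).trans (hC 0 ⟨le_rfl, zero_le_one⟩)
  have hχ'0 : ∀ x, 1 < x → deriv χ x = 0 := fun x hx => by
    have : χ =ᶠ[𝓝 x] fun _ => 1 := by
      filter_upwards [Ioi_mem_nhds hx] with y hy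
      exact Real.smoothTransition.one_of_one_le (le_of_lt hy)
    rw [this.deriv_eq, deriv_const]
  have hχ'0' : ∀ x, x < 0 → deriv χ x = 0 := fun x hx => by
    have : χ =ᶠ[𝓝 x] fun _ => 0 := by
      filter_upwards [Iio_mem_nhds hx] with y hy
      exact Real.smoothTransition.zero_of_nonpos (le_of_lt hy)
    rw [this.deriv_eq, deriv_const]
  have hχ'b : ∀ x, ‖deriv χ x‖ ≤ C := fun x => by
    rcases lt_or_ge x 0 with hx | hx
    · simpa [hχ'0' x hx] using hC0
    · rcases lt_or_ge 1 x with hx1 | hx1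
      · simpa [hχ'0 x hx1] using hC0
      · exact hC x ⟨hx, hx1⟩
  obtain ⟨B, hB⟩ := (isCompact_Icc (a := (0 : ℝ)) (b := b)).exists_bound_of_continuousOn
    hψ.continuous.continuousOn
  have hB0 : 0 ≤ B := (norm_nonneg _).trans (hB 0 ⟨le_rfl, hb.le⟩)
  obtain ⟨B', hB'⟩ := (isCompact_Icc (a := (0 : ℝ)) (b := b)).exists_bound_of_continuousOn
    hψ'c.continuousOn
  set N : ℕ → ℝ := fun n => (n : ℝ) + 1 with hN
  have hN0 : ∀ n, 0 < N n := fun n => by positivity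
  have hNtop : Tendsto N atTop atTop :=
    tendsto_atTop_add_const_right _ _ tendsto_natCast_atTop_atTop
  -- The cut-off `χ (N s - 1)` vanishes for `s ≤ 1 / N` and equals `1` for `s ≥ 2 / N`, so its
  -- product with `ψ` is an admissible test function. It remains to let `N → ∞`.
  have hcut : ∀ n, ∫ s in Ioo 0 b, (N n * deriv χ (N n * s - 1) * ψ s * h s +
      χ (N n * s - 1) * (deriv ψ s * h s)) = - ∫ s in Ioo 0 b, χ (N n * s - 1) * (ψ s * g s) := by
    intro n
    set φ : ℝ → ℝ := fun s => χ (N n * s - 1) * ψ s with hφ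
    have hsm : ContDiff ℝ (⊤ : ℕ∞) φ :=
      (hχ.comp ((contDiff_const.mul contDiff_id).sub contDiff_const)).mul hψ
    have hsupp : Function.support φ ⊆ Icc (1 / N n) b := by
      intro s hs
      rw [Function.mem_support] at hs
      constructor
      · by_contra hcon
        refine hs ?_
        have h1 : N n * s - 1 ≤ 0 := by
          rw [not_le, lt_div_iff₀ (hN0 n)] at hcon
          linarith
        simp [hφ, hχdef, Real.smoothTransition.zero_of_nonpos h1]
      · by_contra hcon
        exact hs (by simp [hφ, hψb s (not_le.1 hcon)])
    have hw := hweak φ hsm (HasCompactSupport.of_support_subset_isCompact isCompact_Icc hsupp)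
      ((closure_minimal hsupp isClosed_Icc).trans fun s hs =>
        ⟨lt_of_lt_of_le (by have := hN0 n; positivity) hs.1, hs.2⟩)
    have hd : ∀ s, deriv φ s = N n * deriv χ (N n * s - 1) * ψ s +
        χ (N n * s - 1) * deriv ψ s := fun s => by
      have h1 : HasDerivAt (fun s => N n * s - 1) (N n) s := by
        simpa using ((hasDerivAt_id s).const_mul (N n)).sub_const 1
      have h2 : HasDerivAt χ (deriv χ (N n * s - 1)) (N n * s - 1) :=
        ((hχ.differentiable (by simp)) _).hasDerivAt
      have h3 := (h2.comp s h1).mul ((hψ.differentiable (by simp)) s).hasDerivAt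
      rw [← mul_comm (N n)] at h3
      exact h3.deriv
    calc _ = ∫ s in Ioo 0 b, deriv φ s * h s := by
          refine integral_congr_ae (Eventually.of_forall fun s => ?_)
          simp only [hd]
          ring
      _ = _ := by
          rw [hw]
          congr 1
          refine integral_congr_ae (Eventually.of_forall fun s => ?_)
          simp only [hφ]
          ring
  have hχn : ∀ n, Continuous fun s => χ (N n * s - 1) := fun n =>
    hχ.continuous.comp (by fun_prop)
  have hbd : ∀ (k : ℝ → ℝ) (K : ℝ), Continuous k → (∀ s ∈ Icc 0 b, ‖k s‖ ≤ K) →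
      ∀ f : ℝ → ℝ, IntegrableOn f (Ioo 0 b) → IntegrableOn (fun s => k s * f s) (Ioo 0 b) :=
    fun k K hk hkb f hf => hf.bdd_mul hk.aestronglyMeasurable
      ((ae_restrict_iff' measurableSet_Ioo).2 (Eventually.of_forall fun s hs =>
        hkb s (Ioo_subset_Icc_self hs)))
  have hψh := hbd _ B' hψ'c hB' h hh
  have hψg := hbd _ B hψ.continuous hB g hg
  have hlim : ∀ f : ℝ → ℝ, IntegrableOn f (Ioo 0 b) →
      Tendsto (fun n => ∫ s in Ioo 0 b, χ (N n * s - 1) * f s) atTop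
        (𝓝 (∫ s in Ioo 0 b, f s)) := by
    intro f hf
    refine tendsto_integral_of_dominated_convergence (fun s => ‖f s‖)
      (fun n => (hχn n).aestronglyMeasurable.mul hf.aestronglyMeasurable) hf.norm
      (fun n => Eventually.of_forall fun s => ?_)
      ((ae_restrict_iff' measurableSet_Ioo).2 (Eventually.of_forall fun s hs => ?_))
    · rw [norm_mul]
      exact mul_le_of_le_one_left (norm_nonneg _) (hχ1 _)
    · refine tendsto_const_nhds.congr' ?_
      filter_upwards [hNtop.eventually_ge_atTop (2 / s)] with n hn
      rw [div_le_iff₀ hs.1] at hn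
      rw [hχdef, Real.smoothTransition.one_of_one_le (by linarith), one_mul]
  -- The derivative of the cut-off has size `N`, but only on an interval of length of order `1 / N`
  -- at the origin, where `h` is small.
  have hbdry : Tendsto (fun n => ∫ s in Ioo 0 b, N n * deriv χ (N n * s - 1) * ψ s * h s) atTop
      (𝓝 0) := by
    rw [Metric.tendsto_atTop']
    intro ε hε
    -- On an interval of length `2 / N` this yields the bound `ε * (C * B / (C * B + 1)) / 2 < ε`;
    -- the `+ 1` keeps the denominator positive.
    obtain ⟨r, hr, hrh⟩ := hzero (ε / (4 * (C * B + 1))) (by positivity)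
    have hev : ∀ᶠ n in atTop, 2 / N n < min r b :=
      (hNtop.const_div_atTop 2).eventually_lt_const (lt_min hr hb)
    obtain ⟨n₀, hn₀⟩ := eventually_atTop.1 hev
    refine ⟨n₀, fun n hn => ?_⟩
    have hn' := hn₀ n hn.le
    have hNn := hN0 n
    rw [dist_zero_right]
    rw [setIntegral_eq_of_subset_of_forall_sdiff_eq_zero (s := Ioc 0 (2 / N n))
      measurableSet_Ioo (fun s hs => ⟨hs.1, hs.2.trans_lt (hn'.trans_le (min_le_right _ _))⟩)]
    · have hle : ∀ᵐ s ∂volume.restrict (Ioc 0 (2 / N n)),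
          ‖N n * deriv χ (N n * s - 1) * ψ s * h s‖ ≤
            N n * C * B * (ε / (4 * (C * B + 1))) := by
        rw [ae_restrict_iff' measurableSet_Ioc]
        filter_upwards [hrh] with s hs hs2
        have h1 := hs ⟨hs2.1, hs2.2.trans_lt (hn'.trans_le (min_le_left _ _))⟩
        have h2 := hB s ⟨hs2.1.le, hs2.2.trans (hn'.le.trans (min_le_right _ _))⟩
        rw [norm_mul, norm_mul, norm_mul, Real.norm_of_nonneg hNn.le]
        have h3 := hχ'b (N n * s - 1)
        gcongr
        exact h1
      refine (norm_setIntegral_le_of_norm_le_const_ae (by simp) hle).trans_lt ?_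
      have hvol : volume.real (Ioc 0 (2 / N n)) = 2 / N n := by
        simp [Measure.real, Real.volume_Ioc]
        positivity
      rw [hvol]
      have e : N n * C * B * (ε / (4 * (C * B + 1))) * (2 / N n) =
          ε * ((C * B) / (C * B + 1)) / 2 := by
        field_simp
        ring
      rw [e]
      have h4 : C * B / (C * B + 1) ≤ 1 := by
        rw [div_le_one (by positivity)]
        linarith
      nlinarith
    · intro s hs
      have h1 : 2 / N n < s := by
        by_contra hcon
        exact hs.2 ⟨hs.1.1, not_lt.1 hcon⟩
      rw [div_lt_iff₀ hNn] at h1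
      rw [hχ'0 _ (by linarith)]
      ring
  have hsum := hbdry.add (hlim _ hψh)
  rw [zero_add] at hsum
  refine tendsto_nhds_unique hsum ((hlim _ hψg).neg.congr fun n => ?_)
  rw [← hcut n, integral_add]
  · have hk : Continuous fun s => N n * deriv χ (N n * s - 1) * ψ s :=
      (continuous_const.mul (hχ'c.comp (by fun_prop))).mul hψ.continuous
    exact hbd _ (N n * C * B) hk (fun s hs => by
      have h2 := hB s hs
      have h3 := hχ'b (N n * s - 1)
      have h4 := (hN0 n).le
      rw [norm_mul, norm_mul, Real.norm_of_nonneg h4]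
      gcongr) h hh
  · exact hbd _ 1 (hχn n) (fun s _ => hχ1 _) _ hψh

end Boundary

/-! ### Test functions carried along characteristics -/

section Representation

variable {μ : ℝ → ℝ} {δ : ℝ} {E : Type*} [NormedAddCommGroup E] [NormedSpace ℝ E]
  [CompleteSpace E]

/-- Test functions supported in `(0, b]` are admissible in `HasMemoryDeriv`, since monotonicity
gives `μ ≥ μ b > 0` there. The representative tending to `0` at the origin supplies the smallness of
`x (η s)`. -/
theorem HasMemoryDeriv.integral_deriv_mul (hμ : IsMemoryKernel μ δ) (hδ : 0 < δ) {b : ℝ}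
    (hb : 0 < b) (hμb : 0 < μ b) {η ξ : MemorySpace μ E} (h : HasMemoryDeriv μ η ξ)
    (x : E →L[ℝ] ℝ) {ψ : ℝ → ℝ} (hψ : ContDiff ℝ (⊤ : ℕ∞) ψ) (hψb : ∀ s, b < s → ψ s = 0) :
    ∫ s in Ioo 0 b, deriv ψ s * x (η s) = - ∫ s in Ioo 0 b, ψ s * x (ξ s) := by
  obtain ⟨K, hK⟩ := hμ.exists_integral_norm_le (E := E) hδ hb hμb
  refine integral_deriv_mul_of_vanishing (x.integrable_comp (hK η).1) (x.integrable_comp (hK ξ).1)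
    (fun φ hφ hφc hφs => ?_) (fun ε hε => ?_) hψ hψb
  · have hsub : tsupport φ ⊆ {s | 0 < s ∧ 0 < μ s} := fun s hs =>
      ⟨(hφs hs).1, hμb.trans_le (hμ.antitoneOn hδ (hφs hs).1.le hb.le (hφs hs).2)⟩
    have key : ∀ (k : ℝ → ℝ) (ζ : MemorySpace μ E), Continuous k → HasCompactSupport k →
        (∀ s ∉ tsupport φ, k s = 0) →
        x (∫ s, k s • ζ s) = ∫ s in Ioo 0 b, k s * x (ζ s) := by
      intro k ζ hk hkc hk0
      obtain ⟨B, hB⟩ := hkc.exists_bound_of_continuous hk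
      have h1 : ∫ s, k s • ζ s = ∫ s in Ioo 0 b, k s • ζ s := by
        rw [← integral_Ioc_eq_integral_Ioo]
        refine (setIntegral_eq_integral_of_forall_compl_eq_zero fun s hs => ?_).symm
        rw [hk0 s fun hs' => hs (hφs hs'), zero_smul]
      have h2 : IntegrableOn (fun s => k s • ζ s) (Ioo 0 b) :=
        (hK ζ).1.bdd_smul B hk.aestronglyMeasurable (Eventually.of_forall hB)
      rw [h1, ← ContinuousLinearMap.integral_comp_comm _ h2]
      simp only [map_smul, smul_eq_mul]
    have h3 := congr_arg x (h.1 φ hφ hφc hsub)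
    rwa [map_neg, key (deriv φ) η (hφ.continuous_deriv (by simp)) hφc.deriv
      fun s hs => Function.notMem_support.1 fun hs' => hs (support_deriv_subset hs'),
      key φ ξ hφ.continuous hφc fun s hs => image_eq_zero_of_notMem_tsupport hs] at h3
  · obtain ⟨g, hg, hg0⟩ := h.2
    have h1 : Tendsto (fun s => |x (g s)|) (𝓝[>] 0) (𝓝 0) := by
      simpa using ((x.continuous.tendsto 0).comp hg0).abs
    obtain ⟨r, hr, hrε⟩ := mem_nhdsGT_iff_exists_Ioo_subset.1 (h1.eventually_le_const hε)
    refine ⟨min r b, lt_min hr hb, ?_⟩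
    have h2 := hμ.ae_restrict hδ hb hμb hg
    rw [ae_restrict_iff' measurableSet_Ioo] at h2
    filter_upwards [h2] with s hs hsr
    rw [hs ⟨hsr.1, hsr.2.trans_le (min_le_right _ _)⟩]
    exact hrε ⟨hsr.1, hsr.2.trans_le (min_le_left _ _)⟩

variable {X : Type*} [NormedAddCommGroup X] [NormedSpace ℝ X] {L : X → X → Prop}
  {π : X →L[ℝ] MemorySpace μ E} {m : X →L[ℝ] ℝ} {x : E →L[ℝ] ℝ}

/-- The coefficient `x` of the component `π U` of `U ∈ D(L)` obeys `x(π (L U)) = -∂_s x(π U) + m U`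
with the boundary condition `π U (0) = 0`. -/
def IsTransported (L : X → X → Prop) (π : X →L[ℝ] MemorySpace μ E) (m : X →L[ℝ] ℝ)
    (x : E →L[ℝ] ℝ) : Prop :=
  ∀ U V, L U V → ∃ w : E, m U = x w ∧ ∃ ξ : MemorySpace μ E, HasMemoryDeriv μ (π U) ξ ∧
    ∀ᵐ s ∂weight μ, π V s = - ξ s + w

/-- The derivative in `σ` of the shifted test function is `-φ'`, which cancels the `φ'` produced by
integrating `-∂_s` by parts. Only the source term survives, weighted by the integral of the shifted
test function. -/
theorem IsTransported.exists_adjointFamily (hμ : IsMemoryKernel μ δ) (hδ : 0 < δ) {b : ℝ}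
    (hb : 0 < b) (hμb : 0 < μ b) (hL : IsTransported L π m x) {φ : ℝ → ℝ}
    (hφ : ContDiff ℝ (⊤ : ℕ∞) φ) (hφc : HasCompactSupport φ) (hφb : ∀ s, b < s → φ s = 0) (t : ℝ) :
    ∃ ℓ ℓ' : ℝ → X →L[ℝ] ℝ,
      IsAdjointFamily L t ℓ ℓ' (fun σ => ∫ s in Ioo 0 b, φ (s + (t - σ))) m ∧
      (∀ σ U, ℓ σ U = ∫ s in Ioo 0 b, φ (s + (t - σ)) * x (π U s)) ∧
      ∀ σ U, π U = 0 → ℓ σ U = 0 := by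
  obtain ⟨C, hC⟩ := hμ.exists_testFunctional hδ hb hμb x
  obtain ⟨K, hK⟩ := hμ.exists_integral_norm_le (E := E) hδ hb hμb
  obtain ⟨B, hB⟩ := hφc.exists_bound_of_continuous hφ.continuous
  have hφ'c : Continuous (deriv φ) := hφ.continuous_deriv (by simp)
  obtain ⟨B', hB'⟩ := hφc.deriv.exists_bound_of_continuous hφ'c
  have hφs : ∀ σ, Continuous fun s => φ (s + (t - σ)) := fun σ =>
    hφ.continuous.comp (by fun_prop)
  have hφ's : ∀ σ, Continuous fun s => - deriv φ (s + (t - σ)) := fun σ =>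
    (hφ'c.comp (by fun_prop)).neg
  choose Φ hΦ hΦC using fun σ : ℝ => hC (fun s => φ (s + (t - σ))) B (hφs σ) fun s => hB _
  choose Φ' hΦ' _ using fun σ : ℝ => hC (fun s => - deriv φ (s + (t - σ))) B' (hφ's σ)
    fun s => by rw [norm_neg]; exact hB' _
  have hint : ∀ η : MemorySpace μ E, IntegrableOn (fun s => x (η s)) (Ioo 0 b) := fun η =>
    x.integrable_comp (hK η).1
  have hφint : ∀ σ (η : MemorySpace μ E),
      IntegrableOn (fun s => φ (s + (t - σ)) * x (η s)) (Ioo 0 b) := fun σ η =>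
    (hint η).bdd_mul (hφs σ).aestronglyMeasurable (Eventually.of_forall fun s => hB _)
  have hφint0 : ∀ σ, IntegrableOn (fun s => φ (s + (t - σ))) (Ioo 0 b) := fun σ =>
    ((hφs σ).integrableOn_Icc).mono_set Ioo_subset_Icc_self
  refine ⟨fun σ => (Φ σ).comp π, fun σ => (Φ' σ).comp π, ⟨⟨B * C * ‖π‖, fun σ => ?_⟩, ?_, ?_, ?_⟩,
    fun σ U => hΦ σ _, fun σ U hU => by simp [hU]⟩
  · exact (ContinuousLinearMap.opNorm_comp_le _ _).trans
      (mul_le_mul_of_nonneg_right (hΦC σ) (norm_nonneg _))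
  · intro U σ
    simp only [ContinuousLinearMap.comp_apply, hΦ, hΦ']
    refine (hasDerivAt_integral_of_dominated_loc_of_deriv_le (s := univ)
      (F := fun σ s => φ (s + (t - σ)) * x (π U s))
      (F' := fun σ s => - deriv φ (s + (t - σ)) * x (π U s))
      (bound := fun s => B' * ‖x (π U s)‖) univ_mem
      (Eventually.of_forall fun τ => (hφint τ _).aestronglyMeasurable) (hφint σ _)
      ((hφ's σ).aestronglyMeasurable.mul (hint _).aestronglyMeasurable)
      (Eventually.of_forall fun s τ _ => ?_) ((hint _).norm.const_mul _)
      (Eventually.of_forall fun s τ _ => ?_)).2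
    · rw [norm_mul, norm_neg]
      exact mul_le_mul_of_nonneg_right (hB' _) (norm_nonneg _)
    · have h1 : HasDerivAt (fun τ => s + (t - τ)) (-1) τ := by
        simpa using ((hasDerivAt_id τ).const_sub t).const_add s
      have h2 := ((hφ.differentiable (by simp)) (s + (t - τ))).hasDerivAt.comp τ h1
      simpa using h2.mul_const (x (π U s))
  · refine continuous_of_dominated (bound := fun _ => B)
      (fun σ => (hφs σ).aestronglyMeasurable) (fun σ => Eventually.of_forall fun s => hB _)
      (integrable_const _) (Eventually.of_forall fun s => hφ.continuous.comp (by fun_prop))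
  · intro σ hσ U V hUV
    obtain ⟨w, hw, ξ, hξ, hV⟩ := hL U V hUV
    simp only [ContinuousLinearMap.comp_apply, hΦ, hΦ']
    -- For `σ < t` the shift moves the support to the left, so the test function still vanishes
    -- beyond `b`, though possibly no longer near `0`.
    have h1 := hξ.integral_deriv_mul hμ hδ hb hμb x (ψ := fun s => φ (s + (t - σ)))
      (hφ.comp (contDiff_id.add contDiff_const)) fun s hs => hφb _ (by linarith [hσ.2])
    simp only [deriv_comp_add_const] at h1
    have h2 : ∫ s in Ioo 0 b, φ (s + (t - σ)) * x (π V s) =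
        - (∫ s in Ioo 0 b, φ (s + (t - σ)) * x (ξ s)) +
          (∫ s in Ioo 0 b, φ (s + (t - σ))) * x w := by
      rw [← integral_neg, ← integral_mul_const,
        ← integral_add (f := fun s => -(φ (s + (t - σ)) * x (ξ s))) (hφint σ ξ).neg
          ((hφint0 σ).mul_const _)]
      refine integral_congr_ae ?_
      filter_upwards [hμ.ae_restrict hδ hb hμb hV] with s hs
      rw [hs, map_add, map_neg]
      ring
    simp only [neg_mul, integral_neg]
    rw [h2, h1, hw]
    ring

/-- The contribution of the source term `q` to the transported variable. -/
theorem integral_integral_shift_mul {b t : ℝ} (ht : 0 ≤ t) {φ q : ℝ → ℝ} (hφ : Continuous φ)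
    (hq : Continuous q) (hφb : ∀ s, b < s → φ s = 0) :
    ∫ τ in (0 : ℝ)..t, (∫ s in Ioo 0 b, φ (s + (t - τ))) * q τ =
      ∫ s in Ioo 0 b, φ s * ∫ τ in max (t - s) 0..t, q τ := by
  set k : ℝ → ℝ → ℝ := fun τ s => (Ioi (t - τ)).indicator (fun s => q τ * φ s) s with hk
  have hki : Integrable (Function.uncurry k)
      ((volume.restrict (Ioc 0 t)).prod (volume.restrict (Ioo 0 b))) := by
    have hset : MeasurableSet {z : ℝ × ℝ | t - z.1 < z.2} :=
      measurableSet_lt (measurable_const.sub measurable_fst) measurable_snd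
    have hke : Function.uncurry k =
        {z : ℝ × ℝ | t - z.1 < z.2}.indicator (fun z => q z.1 * φ z.2) := rfl
    rw [hke]
    exact (Integrable.mul_prod (hq.integrableOn_Icc.mono_set Ioc_subset_Icc_self)
      (hφ.integrableOn_Icc.mono_set Ioo_subset_Icc_self)).indicator hset
  have e1 : ∀ τ ∈ Ioc 0 t, (∫ s in Ioo 0 b, φ (s + (t - τ))) * q τ = ∫ s in Ioo 0 b, k τ s := by
    intro τ hτ
    have hτt : 0 ≤ t - τ := sub_nonneg.2 hτ.2
    have a1 : ∫ s in Ioo 0 b, φ (s + (t - τ)) = ∫ s in Ioi 0, φ (s + (t - τ)) := by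
      rw [← integral_Ioc_eq_integral_Ioo]
      refine (setIntegral_eq_of_subset_of_forall_sdiff_eq_zero measurableSet_Ioi
        (fun s hs => hs.1) fun s hs => hφb _ ?_).symm
      have : b < s := by
        by_contra hcon
        exact hs.2 ⟨hs.1, not_lt.1 hcon⟩
      linarith
    have a2 : ∫ s in Ioi 0, φ (s + (t - τ)) = ∫ s in Ioi (t - τ), φ s := by
      rw [← integral_indicator measurableSet_Ioi, ← integral_indicator measurableSet_Ioi,
        ← integral_add_right_eq_self ((Ioi (t - τ)).indicator φ) (t - τ)]
      congr 1
      ext s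
      simp [indicator]
    have a3 : ∫ s in Ioi (t - τ), φ s = ∫ s in Ioo 0 b, (Ioi (t - τ)).indicator φ s := by
      rw [← integral_Ioc_eq_integral_Ioo, setIntegral_indicator measurableSet_Ioi]
      refine setIntegral_eq_of_subset_of_forall_sdiff_eq_zero measurableSet_Ioi
        (fun s hs => hs.2) fun s hs => hφb _ ?_
      by_contra hcon
      exact hs.2 ⟨⟨hτt.trans_lt hs.1, not_lt.1 hcon⟩, hs.1⟩
    rw [a1, a2, a3, ← integral_mul_const]
    refine integral_congr_ae (Eventually.of_forall fun s => ?_)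
    simp only [hk, indicator]
    split_ifs <;> ring
  rw [intervalIntegral.integral_of_le ht, setIntegral_congr_fun measurableSet_Ioc e1,
    integral_integral_swap hki]
  refine setIntegral_congr_fun measurableSet_Ioo fun s hs => ?_
  have hmax : max (t - s) 0 ≤ t := max_le (by linarith [hs.1]) ht
  rw [intervalIntegral.integral_of_le hmax, ← integral_const_mul]
  -- After the change of variables, the times `τ` that reach a given `s` are those with `t - τ < s`.
  have e2 : Ioc (max (t - s) 0) t = Ioc 0 t ∩ Ioi (t - s) := by
    ext τ
    simp only [mem_Ioc, max_lt_iff, mem_inter_iff, mem_Ioi]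
    tauto
  rw [e2, ← setIntegral_indicator measurableSet_Ioi]
  refine setIntegral_congr_fun measurableSet_Ioc fun τ _ => ?_
  simp only [hk, indicator, mem_Ioi, sub_lt_comm]
  split_ifs <;> ring

end Representation

/-! ### Coefficientwise representation of the memory variable -/

section Representation

variable {μ : ℝ → ℝ} {δ : ℝ} {E : Type*} [NormedAddCommGroup E] [NormedSpace ℝ E]
  [CompleteSpace E] {X : Type*} [NormedAddCommGroup X] [NormedSpace ℝ X] [CompleteSpace X]
  {L : X → X → Prop} {π : X →L[ℝ] MemorySpace μ E} {m : X →L[ℝ] ℝ} {x : E →L[ℝ] ℝ}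

/-- Pairing with the shifted test functions gives the identity tested against every smooth `φ` with
compact support in the open set `{s > 0 : μ s > 0}`; the fundamental lemma of the calculus of
variations concludes. The indicator and the maximum merge the cases `s < t` and `s > t`. -/
theorem IsMildSolution.transported_coeff (hμ : IsMemoryKernel μ δ) (hδ : 0 < δ) {f : X → X}
    {T : ℝ} {U₀ : X} {U : ℝ → X} (hU : IsMildSolution L f T U₀ U) (hL : IsTransported L π m x)
    (hf : ∀ V, π (f V) = 0) {t : ℝ} (ht : t ∈ Icc 0 T) :
    ∀ᵐ s ∂weight μ, x (π (U t) s) =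
      (Ioi 0).indicator (fun r => x (π U₀ r)) (s - t) + ∫ τ in max (t - s) 0..t, m (U τ) := by
  have hT : 0 ≤ T := ht.1.trans ht.2
  have hUc : ContinuousOn U (Icc 0 T) := by
    obtain ⟨S, -, -, h, -⟩ := hU
    exact h
  -- `U` is controlled only on `[0, T]`; the constant extension is continuous on the whole line,
  -- hence so is `Q`.
  set q : ℝ → ℝ := IccExtend hT ((Icc 0 T).domRestrict fun τ => m (U τ)) with hqdef
  have hq : Continuous q :=
    (continuousOn_iff_continuous_domRestrict.1 (m.continuous.comp_continuousOn hUc)).Icc_extend'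
  have hqU : ∀ τ ∈ Icc 0 t, q τ = m (U τ) := fun τ hτ => by
    rw [hqdef, IccExtend_of_mem hT _ (show τ ∈ Icc 0 T from ⟨hτ.1, hτ.2.trans ht.2⟩)]
    rfl
  have hqi : ∀ s, 0 < s → ∫ τ in max (t - s) 0..t, q τ = ∫ τ in max (t - s) 0..t, m (U τ) := by
    intro s hs
    refine intervalIntegral.integral_congr fun τ hτ => hqU τ ?_
    rw [uIcc_of_le (max_le (by linarith) ht.1)] at hτ
    exact ⟨(le_max_right _ _).trans hτ.1, hτ.2⟩
  set y₀ : ℝ → ℝ := (Ioi 0).indicator fun r => x (π U₀ r) with hy₀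
  set Q : ℝ → ℝ := fun s => ∫ τ in max (t - s) 0..t, q τ with hQdef
  have hQ : Continuous Q := by
    have h1 : Continuous fun s : ℝ => ∫ τ in (0 : ℝ)..max (t - s) 0, q τ :=
      (intervalIntegral.continuous_primitive (fun a b => hq.intervalIntegrable a b) 0).comp
        (by fun_prop)
    refine ((continuous_const (y := ∫ τ in (0 : ℝ)..t, q τ)).sub h1).congr fun s => ?_
    exact intervalIntegral.integral_interval_sub_left (hq.intervalIntegrable 0 t)
      (hq.intervalIntegrable 0 _)
  have hint : ∀ b, 0 < b → 0 < μ b → IntegrableOn (fun s => x (π (U t) s)) (Ioo 0 b) ∧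
      IntegrableOn (fun s => y₀ (s - t)) (Ioo 0 b) := by
    intro b hb hμb
    obtain ⟨K, hK⟩ := hμ.exists_integral_norm_le (E := E) hδ hb hμb
    refine ⟨x.integrable_comp (hK _).1, ?_⟩
    have h1 : Integrable ((Ioo 0 b).indicator fun r => x (π U₀ r)) :=
      IntegrableOn.integrable_indicator (x.integrable_comp (hK _).1) measurableSet_Ioo
    refine ((h1.comp_sub_right t).integrableOn (s := Ioo 0 b)).congr_fun (fun s hs => ?_)
      measurableSet_Ioo
    simp only [hy₀, indicator, mem_Ioo, mem_Ioi]
    have : s - t < b := by linarith [hs.2, ht.1]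
    simp [this]
  rw [hμ.ae_weight_iff]
  have key := hμ.isOpen_pos.ae_eq_zero_of_integral_contDiff_smul_eq_zero (μ := volume)
    (f := fun s => x (π (U t) s) - y₀ (s - t) - Q s) ?_ ?_
  · filter_upwards [key] with s hs hsO
    have := hs hsO
    rw [← hqi s hsO.1]
    linarith
  · intro p hp
    obtain ⟨b, hpb, hb⟩ : ∃ b, p < b ∧ b ∈ {s | 0 < s ∧ 0 < μ s} :=
      (inter_mem (nhdsWithin_le_nhds (s := Ioi p) (hμ.isOpen_pos.mem_nhds hp))
        self_mem_nhdsWithin |> Filter.nonempty_of_mem).imp fun b hb => ⟨hb.2, hb.1⟩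
    refine ⟨Ioo 0 b, nhdsWithin_le_nhds (Ioo_mem_nhds hp.1 hpb), ?_⟩
    exact ((hint b hb.1 hb.2).1.sub (hint b hb.1 hb.2).2).sub
      (hQ.integrableOn_Icc.mono_set Ioo_subset_Icc_self)
  intro φ hφ hφc hφs
  rcases (tsupport φ).eq_empty_or_nonempty with hem | hne
  · simp [tsupport_eq_empty_iff.1 hem]
  -- Taking `b` as the maximum of the support gives both `μ b > 0` and the vanishing of `φ` beyond
  -- `b`.
  obtain ⟨b, hbφ, hbmax⟩ := hφc.isCompact.exists_isGreatest hne
  obtain ⟨hb, hμb⟩ := hφs hbφ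
  have hφb : ∀ s, b < s → φ s = 0 := fun s hs =>
    image_eq_zero_of_notMem_tsupport fun hs' => (hbmax hs').not_gt hs
  have hφ0 : ∀ s ∉ Ioc 0 b, φ s = 0 := fun s hs =>
    image_eq_zero_of_notMem_tsupport fun hs' => hs ⟨(hφs hs').1, hbmax hs'⟩
  obtain ⟨B, hB⟩ := hφc.exists_bound_of_continuous hφ.continuous
  obtain ⟨ℓ, ℓ', hadj, hℓ, hℓ0⟩ := hL.exists_adjointFamily hμ hδ hb hμb hφ hφc hφb t
  have hpair := hU.pairing ht hadj fun σ V => hℓ0 σ _ (hf V)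
  have e1 : ∫ τ in (0 : ℝ)..t, (∫ s in Ioo 0 b, φ (s + (t - τ))) * m (U τ) =
      ∫ s in Ioo 0 b, φ s * Q s := by
    rw [hQdef, ← integral_integral_shift_mul ht.1 hφ.continuous hq hφb]
    refine intervalIntegral.integral_congr fun τ hτ => ?_
    rw [uIcc_of_le ht.1] at hτ
    simp only [hqU τ hτ]
  -- At `σ = 0` the shift by `t` is moved from the test function onto the initial history, extended
  -- by zero to nonpositive arguments.
  have e2 : ∫ s in Ioo 0 b, φ (s + t) * x (π U₀ s) = ∫ s in Ioo 0 b, φ s * y₀ (s - t) := by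
    have a1 : ∫ s in Ioo 0 b, φ (s + t) * x (π U₀ s) = ∫ s, φ (s + t) * y₀ s := by
      rw [← integral_Ioc_eq_integral_Ioo]
      rw [← setIntegral_eq_integral_of_forall_compl_eq_zero (s := Ioc 0 b)
        (f := fun s => φ (s + t) * y₀ s)]
      · refine setIntegral_congr_fun measurableSet_Ioc fun s hs => ?_
        simp only [hy₀, indicator_of_mem (show s ∈ Ioi 0 from hs.1)]
      · intro s hs
        by_cases h0 : 0 < s
        · have : b < s := by
            by_contra hcon
            exact hs ⟨h0, not_lt.1 hcon⟩
          rw [hφb _ (by linarith [ht.1]), zero_mul]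
        · rw [hy₀, indicator_of_notMem (by simpa using h0), mul_zero]
    rw [a1, ← integral_sub_right_eq_self _ t, ← integral_Ioc_eq_integral_Ioo,
      setIntegral_eq_integral_of_forall_compl_eq_zero fun s hs => by rw [hφ0 s hs, zero_mul]]
    simp only [sub_add_cancel]
  rw [e1, hℓ, hℓ, sub_self, sub_zero] at hpair
  simp only [add_zero] at hpair
  rw [e2] at hpair
  have hmul : ∀ g : ℝ → ℝ, IntegrableOn g (Ioo 0 b) →
      IntegrableOn (fun s => φ s * g s) (Ioo 0 b) := fun g hg =>
    hg.bdd_mul hφ.continuous.aestronglyMeasurable (Eventually.of_forall hB)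
  rw [← setIntegral_eq_integral_of_forall_compl_eq_zero (s := Ioc 0 b)
    fun s hs => by rw [hφ0 s hs, zero_smul], integral_Ioc_eq_integral_Ioo]
  simp only [smul_eq_mul, mul_sub]
  have i1 := hmul _ (hint b hb hμb).1
  have i2 := hmul _ (hint b hb hμb).2
  have i3 := hmul _ (hQ.integrableOn_Icc.mono_set Ioo_subset_Icc_self)
  rw [integral_sub (f := fun s => φ s * x (π (U t) s) - φ s * y₀ (s - t)) (i1.sub i2) i3,
    integral_sub i1 i2, hpair, sub_self]

end Representation

/-! ### Application to the plate system -/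

section Plate

variable {H : Type*} [NormedAddCommGroup H] [InnerProductSpace ℝ H] {D : EigenSystem H}

theorem EigenSystem.ext_inner (D : EigenSystem H) {v w : H}
    (h : ∀ k, inner ℝ (D.e k) v = inner ℝ (D.e k) w) : v = w := by
  apply D.e.repr.injective
  ext k
  rw [D.e.repr_apply_apply, D.e.repr_apply_apply, h]

/-- The coefficient `v ↦ (v, e k)` as a bounded functional on `F_r`. -/
noncomputable def coeffF (D : EigenSystem H) (r : ℝ) (k : ℕ) : F D r →L[ℝ] ℝ :=
  LinearMap.mkContinuous ((innerSL ℝ (D.e k)).toLinearMap.comp (incl D r))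
    (‖D.e k‖ * (D.lam k ^ r)⁻¹) fun v => by
      have hpos := Real.rpow_pos_of_pos (D.lam_pos k) r
      have h1 : D.lam k ^ r * inner ℝ (D.e k) (incl D r v) = inner ℝ (D.e k) (pow D r v) :=
        (inner_powA D r v k).symm
      have h2 : ‖inner ℝ (D.e k) (pow D r v)‖ ≤ ‖D.e k‖ * ‖v‖ := norm_inner_le_norm _ _
      rw [← h1, norm_mul, Real.norm_of_nonneg hpos.le] at h2
      change ‖inner ℝ (D.e k) (incl D r v)‖ ≤ _
      rw [mul_right_comm, ← div_eq_mul_inv, le_div_iff₀ hpos, mul_comm]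
      exact h2

theorem coeffF_apply (r : ℝ) (k : ℕ) (v : F D r) :
    coeffF D r k v = inner ℝ (D.e k) (incl D r v) := rfl

theorem ext_coeffF {r : ℝ} {v w : F D r} (h : ∀ k, coeffF D r k v = coeffF D r k w) : v = w :=
  Subtype.ext (D.ext_inner h)

variable {μ₁ μ₂ : ℝ → ℝ}

/-- The component `u` as a bounded linear map. -/
noncomputable def uCLM (D : EigenSystem H) (μ₁ μ₂ : ℝ → ℝ) : Phase D μ₁ μ₂ →L[ℝ] F D 1 :=
  ContinuousLinearMap.fst ℝ _ _

/-- The component `w` as a bounded linear map. -/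
noncomputable def wCLM (D : EigenSystem H) (μ₁ μ₂ : ℝ → ℝ) : Phase D μ₁ μ₂ →L[ℝ] H :=
  (ContinuousLinearMap.fst ℝ _ _).comp (ContinuousLinearMap.snd ℝ _ _)

/-- The component `v` as a bounded linear map. -/
noncomputable def vCLM (D : EigenSystem H) (μ₁ μ₂ : ℝ → ℝ) : Phase D μ₁ μ₂ →L[ℝ] H :=
  (ContinuousLinearMap.fst ℝ _ _).comp
    ((ContinuousLinearMap.snd ℝ _ _).comp (ContinuousLinearMap.snd ℝ _ _))

/-- The component `η̄` as a bounded linear map. -/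
noncomputable def etaBarCLM (D : EigenSystem H) (μ₁ μ₂ : ℝ → ℝ) :
    Phase D μ₁ μ₂ →L[ℝ] MemorySpace μ₁ (F D 1) :=
  (ContinuousLinearMap.fst ℝ _ _).comp ((ContinuousLinearMap.snd ℝ _ _).comp
    ((ContinuousLinearMap.snd ℝ _ _).comp (ContinuousLinearMap.snd ℝ _ _)))

/-- The component `η` as a bounded linear map. -/
noncomputable def etaCLM (D : EigenSystem H) (μ₁ μ₂ : ℝ → ℝ) :
    Phase D μ₁ μ₂ →L[ℝ] MemorySpace μ₂ (F D (1 / 2)) :=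
  (ContinuousLinearMap.snd ℝ _ _).comp ((ContinuousLinearMap.snd ℝ _ _).comp
    ((ContinuousLinearMap.snd ℝ _ _).comp (ContinuousLinearMap.snd ℝ _ _)))

variable {β ω ν : ℝ} {f : Phase D μ₁ μ₂ → Phase D μ₁ μ₂} {T : ℝ} {U₀ : Phase D μ₁ μ₂}
  {U : ℝ → Phase D μ₁ μ₂}

theorem isTransported_etaBar (k : ℕ) :
    IsTransported (LinGraph D β ω ν μ₁ μ₂) (etaBarCLM D μ₁ μ₂)
      ((innerSL ℝ (D.e k)).comp (wCLM D μ₁ μ₂)) (coeffF D 1 k) := by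
  intro U V hUV
  obtain ⟨w, hw, h⟩ := hUV.comp_etaBar
  refine ⟨w, ?_, h⟩
  rw [coeffF_apply, hw]
  rfl

theorem isTransported_eta (k : ℕ) :
    IsTransported (LinGraph D β ω ν μ₁ μ₂) (etaCLM D μ₁ μ₂)
      ((innerSL ℝ (D.e k)).comp (vCLM D μ₁ μ₂)) (coeffF D (1 / 2) k) := by
  intro U V hUV
  obtain ⟨v, hv, h⟩ := hUV.comp_eta
  refine ⟨v, ?_, h⟩
  rw [coeffF_apply, hv]
  rfl

/-- The constant family encodes `u' = w` coefficientwise. For a mild solution, `w` takes values only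
in `H`, so its integral is compared with `u` through coefficients and not in `F_1`. -/
theorem isAdjointFamily_u (t : ℝ) (k : ℕ) :
    IsAdjointFamily (LinGraph D β ω ν μ₁ μ₂) t
      (fun _ => (coeffF D 1 k).comp (uCLM D μ₁ μ₂)) (fun _ => 0) (fun _ => 1)
      ((innerSL ℝ (D.e k)).comp (wCLM D μ₁ μ₂)) where
  bounded := ⟨_, fun _ => le_rfl⟩
  hasDerivAt x σ := hasDerivAt_const _ _
  continuous_coeff := continuous_const
  apply_add σ _ U V hUV := by
    change inner ℝ (D.e k) (incl D 1 (uPart V)) + 0 = 1 * inner ℝ (D.e k) (wPart U)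
    rw [hUV.comp_u]
    ring

variable [CompleteSpace H]

theorem IsMildSolution.etaBar_eq (hU : IsMildSolution (LinGraph D β ω ν μ₁ μ₂) f T U₀ U)
    (hfu : ∀ V, uPart (f V) = 0) (hfη : ∀ V, etaBar (f V) = 0) {δ : ℝ} (hδ : 0 < δ)
    (hμ : IsMemoryKernel μ₁ δ) {t : ℝ} (ht : t ∈ Icc 0 T) :
    ∀ᵐ s ∂weight μ₁,
      (s < t → etaBar (U t) s = uPart (U t) - uPart (U (t - s))) ∧
      (t ≤ s → etaBar (U t) s = etaBar U₀ (s - t) + uPart (U t) - uPart (U 0)) := by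
  have := completeSpace_F D (zero_le_one (α := ℝ))
  have := completeSpace_F D (show (0 : ℝ) ≤ 1 / 2 by norm_num)
  have hUc : ContinuousOn U (Icc 0 T) := by
    obtain ⟨S, -, -, h, -⟩ := hU
    exact h
  have hu : ∀ k, ∀ r ∈ Icc 0 t, ∫ τ in r..t, inner ℝ (D.e k) (wPart (U τ)) =
      coeffF D 1 k (uPart (U t)) - coeffF D 1 k (uPart (U r)) := by
    intro k r hr
    have hpair : ∀ a ∈ Icc 0 T, coeffF D 1 k (uPart (U a)) - coeffF D 1 k (uPart U₀) =
        ∫ τ in (0 : ℝ)..a, 1 * inner ℝ (D.e k) (wPart (U τ)) := fun a ha =>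
      hU.pairing ha (isAdjointFamily_u a k) fun σ V => by
        change coeffF D 1 k (uPart (f V)) = 0
        rw [hfu, map_zero]
    have hi : ∀ a ∈ Icc 0 T,
        IntervalIntegrable (fun τ => inner ℝ (D.e k) (wPart (U τ))) volume 0 a := by
      intro a ha
      refine ContinuousOn.intervalIntegrable ?_
      rw [uIcc_of_le ha.1]
      exact ((innerSL ℝ (D.e k)).comp (wCLM D μ₁ μ₂)).continuous.comp_continuousOn
        (hUc.mono (Icc_subset_Icc_right ha.2))
    have hrT : r ∈ Icc 0 T := ⟨hr.1, hr.2.trans ht.2⟩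
    have h1 := hpair t ht
    have h2 := hpair r hrT
    simp only [one_mul] at h1 h2
    rw [← intervalIntegral.integral_interval_sub_left (hi t ht) (hi r hrT), ← h1, ← h2]
    ring
  -- Each coefficient has its own exceptional null set; their countable union is still null.
  have hall := ae_all_iff.2 fun k =>
    hU.transported_coeff hμ hδ (isTransported_etaBar k) hfη ht
  -- At `s = t` the indicator over `Ioi 0` gives zero instead of the initial history; this single
  -- point is null.
  have hne : ∀ᵐ s ∂weight μ₁, 0 < s ∧ s ≠ t := by
    rw [hμ.ae_weight_iff]
    filter_upwards [Measure.ae_ne volume t] with s hs hs' using ⟨hs'.1, hs⟩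
  filter_upwards [hall, hne] with s hs hs0
  refine ⟨fun hst => ext_coeffF fun k => ?_, fun hst => ext_coeffF fun k => ?_⟩
  · refine (hs k).trans ?_
    have h1 := hu k (t - s) ⟨by linarith, by linarith [hs0.1]⟩
    rw [indicator_of_notMem (by simpa using hst.le), zero_add, max_eq_left (by linarith), map_sub]
    exact h1
  · have hst' : t < s := lt_of_le_of_ne hst (Ne.symm hs0.2)
    refine (hs k).trans ?_
    have h1 := hu k 0 ⟨le_rfl, ht.1⟩
    rw [indicator_of_mem (by simpa using hst'), max_eq_right (by linarith), add_sub_assoc,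
      map_add, map_sub, ← h1]
    rfl

/-- No further equation is needed here: the source `v` is a component of `U`, continuous into `H`,
so its integral exists in `H` and commutes with taking coefficients. -/
theorem IsMildSolution.eta_eq (hU : IsMildSolution (LinGraph D β ω ν μ₁ μ₂) f T U₀ U)
    (hfη : ∀ V, eta (f V) = 0) {δ : ℝ} (hδ : 0 < δ)
    (hμ : IsMemoryKernel μ₂ δ) {t : ℝ} (ht : t ∈ Icc 0 T) :
    ∀ᵐ s ∂weight μ₂,
      (s < t → incl D (1 / 2) (eta (U t) s) = ∫ y in (0 : ℝ)..s, vPart (U (t - y))) ∧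
      (t ≤ s → incl D (1 / 2) (eta (U t) s) =
        incl D (1 / 2) (eta U₀ (s - t)) + ∫ y in (0 : ℝ)..t, vPart (U (t - y))) := by
  have := completeSpace_F D (zero_le_one (α := ℝ))
  have := completeSpace_F D (show (0 : ℝ) ≤ 1 / 2 by norm_num)
  have hUc : ContinuousOn U (Icc 0 T) := by
    obtain ⟨S, -, -, h, -⟩ := hU
    exact h
  have hv : ∀ k, ∀ r ∈ Icc 0 t, inner ℝ (D.e k) (∫ y in (0 : ℝ)..r, vPart (U (t - y))) =
      ∫ τ in t - r..t, inner ℝ (D.e k) (vPart (U τ)) := by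
    intro k r hr
    rw [intervalIntegral.integral_comp_sub_left (fun τ => vPart (U τ)), sub_zero]
    refine (ContinuousLinearMap.intervalIntegral_comp_comm (innerSL ℝ (D.e k)) ?_).symm
    refine ContinuousOn.intervalIntegrable ?_
    rw [uIcc_of_le (by linarith [hr.1])]
    exact (vCLM D μ₁ μ₂).continuous.comp_continuousOn
      (hUc.mono (Icc_subset_Icc (by linarith [hr.2]) ht.2))
  have hall := ae_all_iff.2 fun k =>
    hU.transported_coeff hμ hδ (isTransported_eta k) hfη ht
  have hne : ∀ᵐ s ∂weight μ₂, 0 < s ∧ s ≠ t := by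
    rw [hμ.ae_weight_iff]
    filter_upwards [Measure.ae_ne volume t] with s hs hs' using ⟨hs'.1, hs⟩
  filter_upwards [hall, hne] with s hs hs0
  refine ⟨fun hst => D.ext_inner fun k => ?_, fun hst => D.ext_inner fun k => ?_⟩
  · refine (hs k).trans ?_
    rw [indicator_of_notMem (by simpa using hst.le), zero_add, max_eq_left (by linarith),
      hv k s ⟨hs0.1.le, hst.le⟩]
    rfl
  · have hst' : t < s := lt_of_le_of_ne hst (Ne.symm hs0.2)
    refine (hs k).trans ?_
    rw [indicator_of_mem (by simpa using hst'), max_eq_right (by linarith), inner_add_right,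
      hv k t ⟨ht.1, le_rfl⟩, sub_self]
    rfl

end Plate

end PlateMemory

theorem mainTheorem11 {H : Type*} [NormedAddCommGroup H] [InnerProductSpace ℝ H] [CompleteSpace H]
    (D : PlateMemory.EigenSystem H) (β ω ν : ℝ) (hβ : 0 < β) (hω : 0 ≤ ω) (hν : 0 < ν)
    (μ₁ μ₂ : ℝ → ℝ) (δ₁ δ₂ : ℝ) (hδ₁ : 0 < δ₁) (hδ₂ : 0 < δ₂)
    (hμ₁ : PlateMemory.IsMemoryKernel μ₁ δ₁) (hμ₂ : PlateMemory.IsMemoryKernel μ₂ δ₂)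
    (M : ℝ → ℝ) (hM : ContDiffOn ℝ 2 M (Ioi 0))
    (hMint : ∀ z, 0 ≤ z → IntervalIntegrable M volume 0 z)
    (a b : ℝ) (ha : a ∈ Ioo 0 (D.lam 0))
    (hMbound : ∀ z, 0 ≤ z → - a * z - b ≤ ∫ ξ in (0 : ℝ)..z, M ξ)
    (p : H) (T : ℝ) (hT : 0 < T) (U₀ : PlateMemory.Phase D μ₁ μ₂) (U : ℝ → PlateMemory.Phase D μ₁ μ₂)
    (hU : PlateMemory.IsMildSolution (PlateMemory.LinGraph D β ω ν μ₁ μ₂) (PlateMemory.nonlin D μ₁ μ₂ M p) T U₀ U) :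
    ∀ t ∈ Icc 0 T,
      (∀ᵐ s ∂PlateMemory.weight μ₁,
        (s < t → PlateMemory.etaBar (U t) s = PlateMemory.uPart (U t) - PlateMemory.uPart (U (t - s))) ∧
        (t ≤ s → PlateMemory.etaBar (U t) s = PlateMemory.etaBar U₀ (s - t) + PlateMemory.uPart (U t) - PlateMemory.uPart (U 0))) ∧
      (∀ᵐ s ∂PlateMemory.weight μ₂,
        (s < t → PlateMemory.incl D (1 / 2) (PlateMemory.eta (U t) s) = ∫ y in (0 : ℝ)..s, PlateMemory.vPart (U (t - y))) ∧
        (t ≤ s → PlateMemory.incl D (1 / 2) (PlateMemory.eta (U t) s) =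
          PlateMemory.incl D (1 / 2) (PlateMemory.eta U₀ (s - t)) + ∫ y in (0 : ℝ)..t, PlateMemory.vPart (U (t - y)))) := by
  intro t ht
  -- The nonlinearity has zero `u`, `η̄` and `η` components by definition.
  exact ⟨hU.etaBar_eq (fun _ => rfl) (fun _ => rfl) hδ₁ hμ₁ ht,
    hU.eta_eq (fun _ => rfl) hδ₂ hμ₂ ht⟩
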